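/- Let $m\ge 0$ and let $F_m$ be the free group on $m$ generators. For every $n\ge 1$ there is a unique polynomial $A_n^{\mathrm{irr}}(q)\in\mathbb{Q}[q]$ whose value at $q=|k|$, for every finite field $k$, is the number of isomorphism classes of absolutely irreducible $n$-dimensional representations of $F_m$ over $k$, that is, of representations that stay irreducible under every finite extension of $k$. For $n\ge1$ let $\psi_n$ be the Adams operator on $\mathbb{Q}(q)[[t]]$ given by $\sum_j r_j(q)t^j\mapsto\sum_j r_j(q^n)t^{nj}$ (so $q^it^j\mapsto q^{ni}t^{nj}$), and put $\Psi=\sum_{n\ge1}\frac1n\psi_n$ on series without constant term. Let $J_n$ be the set of subgroups of index $n$ of $F_m$. Then $$\Psi\Bigl(\sum_{n\ge1}\frac{A_n^{\mathrm{irr}}(q)}{q-1}t^n\Bigr)\Big|_{t=\frac{x}{(q-1)^{m-1}},\ q=1}=\sum_{n\ge1}\frac{|J_n|}{n}x^n .$$ Here $\Psi$ is applied first, then $t=x/(q-1)^{m-1}$ is substituted; the coefficients of the resulting series in $x$ are rational functions of $q$ without a pole at $q=1$, and they are then evaluated at $q=1$. -/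

import Mathlib

open Polynomial PowerSeries
open scoped TensorProduct

namespace CharVar

/-! ### Absolutely irreducible representations of free groups -/

/-- Extension of scalars of a representation along a field extension `K / k`. -/
noncomputable def scalarExt {k G V : Type*} [Field k] [Group G] [AddCommGroup V] [Module k V]
    (K : Type*) [Field K] [Algebra k K] (ρ : Representation k G V) :
    Representation K G (K ⊗[k] V) where
  toFun g := (ρ g).baseChange K
  map_one' := by rw [map_one]; exact LinearMap.baseChange_id
  map_mul' g h := by rw [map_mul]; exact LinearMap.baseChange_comp _ _

/-- A representation is absolutely irreducible if it stays irreducible under every finite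
extension of the base field (including the trivial extension). -/
def IsAbsIrreducible {k : Type} {G V : Type*} [Field k] [Group G] [AddCommGroup V] [Module k V]
    (ρ : Representation k G V) : Prop :=
  ∀ (K : Type) [Field K] [Algebra k K] [FiniteDimensional k K],
    (scalarExt K ρ).IsIrreducible

/-- Absolutely irreducible representations of the free group `F_m` on `k ^ n`. -/
abbrev AbsIrrRep (m n : ℕ) (k : Type) [Field k] : Type :=
  {ρ : Representation k (FreeGroup (Fin m)) (Fin n → k) // IsAbsIrreducible ρ}

/-- Isomorphism of representations. -/
instance absIrrSetoid (m n : ℕ) (k : Type) [Field k] : Setoid (AbsIrrRep m n k) where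
  r ρ σ := Nonempty (Representation.Equiv ρ.1 σ.1)
  iseqv :=
    { refl := fun ρ => ⟨Representation.Equiv.refl ρ.1⟩
      symm := fun ⟨e⟩ => ⟨e.symm⟩
      trans := fun ⟨e⟩ ⟨f⟩ => ⟨e.trans f⟩ }

/-- The number of isomorphism classes of absolutely irreducible `n`-dimensional representations
of the free group `F_m` over `k`. -/
noncomputable def absIrrCount (m n : ℕ) (k : Type) [Field k] : ℕ :=
  Nat.card (Quotient (absIrrSetoid m n k))

/-- The polynomial `A` counts the isomorphism classes of absolutely irreducible `n`-dimensional
representations of `F_m` over all finite fields. -/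
def IsCountingPolynomial (m n : ℕ) (A : ℚ[X]) : Prop :=
  ∀ (k : Type) [Field k] [Finite k], A.eval (Nat.card k : ℚ) = absIrrCount m n k

/-! ### The operator `Ψ` on power series in `t` over `ℚ(q)` -/

/-- The substitution `q ↦ q ^ n` on `ℚ(q)` (used for `n ≥ 1`, where no denominator vanishes). -/
noncomputable def substPow (n : ℕ) (r : RatFunc ℚ) : RatFunc ℚ :=
  RatFunc.eval (algebraMap ℚ (RatFunc ℚ)) (RatFunc.X ^ n) r

/-- The Adams operator `ψ_n`, `q ^ i * t ^ j ↦ q ^ (n * i) * t ^ (n * j)`, for `n ≥ 1`. -/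
noncomputable def adams (n : ℕ) (f : (RatFunc ℚ)⟦X⟧) : (RatFunc ℚ)⟦X⟧ :=
  PowerSeries.mk fun k => if n ∣ k then substPow n (PowerSeries.coeff (k / n) f) else 0

/-- For `n > k ≥ 1`, the operator `ψ_n` contributes nothing to the coefficient of `t ^ k`. -/
theorem coeff_adams_eq_zero {n k : ℕ} (hk : 1 ≤ k) (hn : k < n) (f : (RatFunc ℚ)⟦X⟧) :
    PowerSeries.coeff k (adams n f) = 0 := by
  have h : ¬ n ∣ k := fun h => absurd (Nat.le_of_dvd hk h) (by omega)
  simp [adams, h]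

/-- `Ψ = ∑_{n ≥ 1} (1 / n) ψ_n` on series without constant term. On the coefficient of `t ^ k`
the operators `ψ_n` with `n > k` contribute zero, so the sum is taken over `1 ≤ n ≤ k`. -/
noncomputable def Psi (f : (RatFunc ℚ)⟦X⟧) : (RatFunc ℚ)⟦X⟧ :=
  PowerSeries.mk fun k =>
    ∑ n ∈ Finset.Icc 1 k, (n : RatFunc ℚ)⁻¹ * PowerSeries.coeff k (adams n f)

/-- The series `∑_{n ≥ 1} A_n(q) / (q - 1) t ^ n`. -/
noncomputable def irrSeries (A : ℕ → ℚ[X]) : (RatFunc ℚ)⟦X⟧ :=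
  PowerSeries.mk fun n =>
    if n = 0 then 0 else algebraMap ℚ[X] (RatFunc ℚ) (A n) / (RatFunc.X - 1)

/-- The substitution `t = x / (q - 1) ^ (m - 1)`; the exponent `m - 1` is an integer. -/
noncomputable def substT (m : ℕ) (f : (RatFunc ℚ)⟦X⟧) : (RatFunc ℚ)⟦X⟧ :=
  PowerSeries.rescale (((RatFunc.X - 1 : RatFunc ℚ) ^ ((m : ℤ) - 1))⁻¹) f

/-- The specialization of `f` at `q = 1` is defined and equal to `g`: no coefficient of `f` has a
pole at `q = 1`, and the values there are the coefficients of `g`. -/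
def SpecializesAtOne (f : (RatFunc ℚ)⟦X⟧) (g : ℚ⟦X⟧) : Prop :=
  ∀ n : ℕ, (PowerSeries.coeff n f).denom.eval 1 ≠ 0 ∧
    RatFunc.eval (RingHom.id ℚ) 1 (PowerSeries.coeff n f) = PowerSeries.coeff n g

/-! ### Subgroups of finite index -/

/-- The set `J_n` of subgroups of index `n` of the free group `F_m` (for `n ≥ 1`). -/
def indexSubgroups (m n : ℕ) : Set (Subgroup (FreeGroup (Fin m))) :=
  {H | H.index = n}

/-- The series `∑_{n ≥ 1} |J_n| / n x ^ n`. -/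
noncomputable def subgroupSeries (m : ℕ) : ℚ⟦X⟧ :=
  PowerSeries.mk fun n => if n = 0 then 0 else ((indexSubgroups m n).ncard : ℚ) / n

end CharVar

/-! Fix a finite field `k` with `q` elements and let `S` run over the irreducible representations of
`F_m` over `k`, with `Q_S = |End S|`. In a nonzero finite module `ρ` the Möbius function of the
semisimple submodules sums to zero. Written with injections instead of submodules, `N = ⊕ S^{j_S}`
gets the weight `∏ eulerCoeff Q_S j_S`, the sum factors over `S`, and the factor of any `S` in the
socle of `ρ` vanishes by a finite q-identity (`sum_eulerCoeff_mul_prod_eq_zero`).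

Now sum over all `ρ` on `k^n`. Since `GL_n` is transitive on linear injections `N → k^n`, the pairs
(`ρ`, embedding of `N` in `ρ`) number `|GL_n| stab(n,d)^{m-1}`, where `d = dim N ≤ n` and `stab(n,d)
= ∏_{d≤i<n} (q^n - q^i)`; only the dimension of `N` matters. So the series `P = ∏_S ∑_j eulerCoeff
Q_S j t^{j dim S}` has `P_0 = 1` and `∑_{d≤n} P_d stab(n,d)^{m-1} = 0` for `n ≥ 1`
(`sum_coeff_irrProduct`). This recursion determines `P` and makes its coefficients rational
functions of `q` (`universalCoeff`).

The logarithmic derivative of `P` is a sum over `S`. Galois descent (`absIrrCount_eq_sum`) expresses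
the absolutely irreducible classes over the degree `r` extension of `k` through the same `S`, and
comparison gives `-log P = Ψ(∑ A_n t^n/(q-1))`. The `r = 1` term isolates `A_n`, which is thus a
rational function of `q`; having integral values at all primes, it is a polynomial.

At `q = 1`, `stab(n,d)/(q-1)^{n-d}` becomes `(n-d)!`, so the substitution for `t` turns the
recursion for `P` into the one for the inverse of `F = ∑ (n!)^{m-1} x^n`, and `Ψ(...)` becomes `log
F`. Hall's recursion (`sum_ncard_indexSubgroups`), a count of actions of `F_m` on `n` points with a
marked point, says `x F'/F = ∑ |J_n| x^n`. -/

namespace CharVar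

/-! ### A finite `q`-series identity -/

/-- The coefficient `∏_{i=1}^j (1 - Q^i)⁻¹`. -/
noncomputable def eulerCoeff (Q : ℚ) (j : ℕ) : ℚ := ∏ i ∈ Finset.range j, (1 - Q ^ (i + 1))⁻¹

theorem one_sub_pow_ne_zero {Q : ℚ} (hQ : 1 < Q) (i : ℕ) : 1 - Q ^ (i + 1) ≠ 0 := by
  have := one_lt_pow₀ hQ (Nat.succ_ne_zero i)
  simp only [Nat.succ_eq_add_one] at this
  linarith

/-- The partial sums telescope: with `∏_{a<N} (H - Q^{a+1})` and `eulerCoeff Q (N+1)` taken out, the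
induction step is `(1 - Q^{N+1}) + (H - 1) = H - Q^{N+1}`. -/
theorem sum_eulerCoeff_mul_prod {Q : ℚ} (hQ : 1 < Q) (H : ℚ) (N : ℕ) :
    ∑ j ∈ Finset.range (N + 1), eulerCoeff Q j * ∏ a ∈ Finset.range j, (H - Q ^ a) =
      eulerCoeff Q N * ∏ a ∈ Finset.range N, (H - Q ^ (a + 1)) := by
  induction N with
  | zero => simp
  | succ N ih =>
    rw [Finset.sum_range_succ, ih, Finset.prod_range_succ' (fun a => H - Q ^ a),
      Finset.prod_range_succ (fun a => H - Q ^ (a + 1))]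
    have h : eulerCoeff Q N = eulerCoeff Q (N + 1) * (1 - Q ^ (N + 1)) := by
      rw [eulerCoeff, eulerCoeff, Finset.prod_range_succ, mul_assoc,
        inv_mul_cancel₀ (one_sub_pow_ne_zero hQ N), mul_one]
    rw [h]
    ring

/-- The closed form contains the factor with `a = h - 1`. This is Möbius inversion in the lattice of
subspaces of an `h`-dimensional space over a field with `Q` elements, with injections counted
instead of subspaces. -/
theorem sum_eulerCoeff_mul_prod_eq_zero {Q : ℚ} (hQ : 1 < Q) {h N : ℕ} (h1 : 1 ≤ h) (hN : h ≤ N) :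
    ∑ j ∈ Finset.range (N + 1), eulerCoeff Q j * ∏ a ∈ Finset.range j, (Q ^ h - Q ^ a) = 0 := by
  rw [sum_eulerCoeff_mul_prod hQ, Finset.prod_eq_zero (i := h - 1), mul_zero]
  · simp; omega
  · rw [Nat.sub_add_cancel h1, sub_self]

/-! ### Counting equivariant points -/

theorem card_smul_eq {Γ Y : Type*} [Group Γ] [Finite Γ] [MulAction Γ Y]
    (htrans : ∀ y y' : Y, ∃ γ : Γ, γ • y = y') {s : ℕ} (hs : Nat.card Y * s = Nat.card Γ)
    (y y' : Y) : Nat.card {γ : Γ // γ • y = y'} = s := by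
  have hY : Finite Y := Finite.of_surjective (fun γ : Γ => γ • y) (htrans y)
  have : Nonempty Y := ⟨y⟩
  have hpt : MulAction.IsPretransitive Γ Y := ⟨htrans⟩
  have h1 : Nat.card {γ : Γ // γ • y = y'} = Nat.card (MulAction.stabilizer Γ y) := by
    obtain ⟨δ, hδ⟩ := htrans y' y
    -- Multiplication by `δ`, which carries `y'` back to `y`, maps the transporter onto the
    -- stabilizer.
    refine Nat.card_congr ((Equiv.mulLeft δ).subtypeEquiv fun γ => ?_)
    simp only [Equiv.coe_mulLeft, MulAction.mem_stabilizer_iff, mul_smul]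
    rw [← hδ, smul_left_cancel_iff]
  have h2 := MulAction.index_stabilizer_of_transitive Γ y
  have h3 := (MulAction.stabilizer Γ y).index_mul_card
  rw [h2, ← hs] at h3
  rw [h1]
  exact Nat.eq_of_mul_eq_mul_left Nat.card_pos h3

/-- If a finite group `Γ` acts transitively on `Y`, the tuples `γ` in `Γ` and points `y` with
prescribed values of `γ i • y` are counted by `|Y| s ^ m`, where `s` is the order of a
stabilizer. -/
theorem card_tuple_smul_eq {Γ Y : Type*} [Group Γ] [Finite Γ] [MulAction Γ Y] [Finite Y]
    (htrans : ∀ y y' : Y, ∃ γ : Γ, γ • y = y') {s : ℕ} (hs : Nat.card Y * s = Nat.card Γ)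
    (m : ℕ) (ν : Fin m → Y → Y) :
    Nat.card {p : (Fin m → Γ) × Y // ∀ i, p.1 i • p.2 = ν i p.2} = Nat.card Y * s ^ m := by
  have e : {p : (Fin m → Γ) × Y // ∀ i, p.1 i • p.2 = ν i p.2} ≃
      Σ y : Y, ∀ i : Fin m, {γ : Γ // γ • y = ν i y} :=
    { toFun := fun p => ⟨p.1.2, fun i => ⟨p.1.1 i, p.2 i⟩⟩
      invFun := fun p => ⟨(fun i => (p.2 i).1, p.1), fun i => (p.2 i).2⟩
      left_inv := fun _ => rfl
      right_inv := fun _ => rfl }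
  have := Fintype.ofFinite Y
  rw [Nat.card_congr e, Nat.card_sigma]
  simp_rw [Nat.card_pi, card_smul_eq htrans hs]
  simp

/-! ### Injective linear maps -/

section Injections

variable {k : Type*} [Field k]

/-- The two images have complements of equal dimension, so the isomorphism between the images
extends. This is the transitivity needed for `card_tuple_smul_eq`. -/
theorem exists_equiv_comp_eq {N V : Type*} [AddCommGroup N] [Module k N] [AddCommGroup V]
    [Module k V] [FiniteDimensional k V] (f g : N →ₗ[k] V)
    (hf : Function.Injective f) (hg : Function.Injective g) :
    ∃ e : (Module.End k V)ˣ, e.1 ∘ₗ f = g := by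
  have : FiniteDimensional k N := FiniteDimensional.of_injective f hf
  let e₀ : LinearMap.range f ≃ₗ[k] LinearMap.range g :=
    (LinearEquiv.ofInjective f hf).symm.trans (LinearEquiv.ofInjective g hg)
  obtain ⟨C, hC⟩ := (LinearMap.range f).exists_isCompl
  obtain ⟨D, hD⟩ := (LinearMap.range g).exists_isCompl
  have hfin : Module.finrank k C = Module.finrank k D := by
    have h1 := Submodule.finrank_add_eq_of_isCompl hC
    have h2 := Submodule.finrank_add_eq_of_isCompl hD
    have h3 := e₀.finrank_eq
    omega
  let e₁ : C ≃ₗ[k] D := LinearEquiv.ofFinrankEq _ _ hfin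
  let E : V ≃ₗ[k] V := (Submodule.prodEquivOfIsCompl _ _ hC).symm.trans
    ((e₀.prodCongr e₁).trans (Submodule.prodEquivOfIsCompl _ _ hD))
  refine ⟨LinearMap.GeneralLinearGroup.ofLinearEquiv E, LinearMap.ext fun x => ?_⟩
  change E (f x) = g x
  have h1 : (Submodule.prodEquivOfIsCompl _ _ hC).symm (f x) =
      (LinearEquiv.ofInjective f hf x, 0) := by
    rw [LinearEquiv.symm_apply_eq]; simp
  simp [E, h1, e₀]

variable [Finite k]

theorem card_injective_linearMap {N V : Type*} [AddCommGroup N] [Module k N] [AddCommGroup V]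
    [Module k V] [FiniteDimensional k N] [FiniteDimensional k V] {d n : ℕ}
    (hd : Module.finrank k N = d) (hn : Module.finrank k V = n) (hdn : d ≤ n) :
    Nat.card {f : N →ₗ[k] V // Function.Injective f} =
      ∏ i ∈ Finset.range d, (Nat.card k ^ n - Nat.card k ^ i) := by
  have := Fintype.ofFinite k
  have : Finite V := Module.finite_of_finite k
  let b := Module.finBasisOfFinrankEq k N hd
  have e : {f : N →ₗ[k] V // Function.Injective f} ≃
      {s : Fin d → V // LinearIndependent k s} := by
    refine (b.constr k).symm.toEquiv.subtypeEquiv fun f => ?_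
    have h : (b.constr k).symm f = f ∘ b := by
      rw [LinearEquiv.symm_apply_eq]; exact b.ext fun i => by simp
    change _ ↔ LinearIndependent k ((b.constr k).symm f)
    rw [h]
    constructor
    · intro hf; exact b.linearIndependent.map' f (LinearMap.ker_eq_bot.2 hf)
    · intro hf
      have h2 : f = Finsupp.linearCombination k (f ∘ b) ∘ₗ b.repr.toLinearMap :=
        b.ext fun i => by simp
      rw [h2]
      exact Function.Injective.comp (g := Finsupp.linearCombination k (f ∘ b)) hf
        b.repr.injective
  rw [Nat.card_congr e, card_linearIndependent (by omega), Finset.prod_range, hn,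
    Nat.card_eq_fintype_card]

theorem card_units_end {V : Type*} [AddCommGroup V] [Module k V] [FiniteDimensional k V] {n : ℕ}
    (hn : Module.finrank k V = n) :
    Nat.card (Module.End k V)ˣ = ∏ i ∈ Finset.range n, (Nat.card k ^ n - Nat.card k ^ i) := by
  rw [← card_injective_linearMap hn hn le_rfl]
  refine Nat.card_congr (Equiv.ofBijective
    (fun e => ⟨e.1, (LinearMap.GeneralLinearGroup.toLinearEquiv e).injective⟩) ⟨?_, ?_⟩)
  · intro e f h
    exact Units.ext (congrArg Subtype.val h)
  · rintro ⟨f, hf⟩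
    exact ⟨LinearMap.GeneralLinearGroup.ofLinearEquiv (LinearEquiv.ofInjectiveEndo f hf),
      Subtype.ext (LinearMap.ext fun _ => rfl)⟩

end Injections

/-! ### Injections out of a product with a simple module -/

section SimpleProduct

variable {A : Type*} [Ring A]

/-- Since `S` is simple, the image of `g` either meets that of `f` trivially or lies inside it; in
the second case `g` factors through `f`. -/
theorem coprod_injective_iff {N S M : Type*} [AddCommGroup N] [Module A N] [AddCommGroup S]
    [Module A S] [AddCommGroup M] [Module A M] [IsSimpleModule A S]
    (f : N →ₗ[A] M) (g : S →ₗ[A] M) (hf : Function.Injective f) :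
    Function.Injective (f.coprod g) ↔ ¬ ∃ h : S →ₗ[A] N, f ∘ₗ h = g := by
  constructor
  · rintro hinj ⟨h, rfl⟩
    have := IsSimpleModule.nontrivial A S
    obtain ⟨s, hs⟩ := exists_ne (0 : S)
    have := @hinj (h s, -s) 0 (by simp)
    exact hs (by simpa using congrArg Prod.snd this)
  · intro hne
    rw [← LinearMap.ker_eq_bot, LinearMap.ker_eq_bot']
    rintro ⟨n, s⟩ hns
    rw [LinearMap.coprod_apply] at hns
    by_cases hs : s = 0
    · subst hs
      simp only [map_zero, add_zero] at hns
      rw [hf (hns.trans (map_zero f).symm)]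
      rfl
    · exfalso
      have hmem : s ∈ (LinearMap.range f).comap g :=
        ⟨-n, by rw [map_neg]; exact (eq_neg_of_add_eq_zero_right hns).symm⟩
      have htop : (LinearMap.range f).comap g = ⊤ := by
        refine (eq_bot_or_eq_top _).resolve_left fun hb => hs ?_
        rw [hb] at hmem
        exact hmem
      have hle : ∀ x, g x ∈ LinearMap.range f := fun x => by
        have : x ∈ (LinearMap.range f).comap g := htop ▸ Submodule.mem_top
        exact this
      refine hne ⟨(LinearEquiv.ofInjective f hf).symm.toLinearMap ∘ₗ g.codRestrict _ hle, ?_⟩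
      ext x
      simp

/-- An injection `f` on `N` extends to `N × S` by any `g` that does not factor through `f`; those
that do factor correspond to `Hom(S, N)`, whatever `f` is. -/
theorem card_injective_prod {N S M : Type*} [AddCommGroup N] [Module A N] [AddCommGroup S]
    [Module A S] [AddCommGroup M] [Module A M] [IsSimpleModule A S]
    [Finite N] [Finite S] [Finite M] :
    (Nat.card {f : N × S →ₗ[A] M // Function.Injective f} : ℚ) =
      Nat.card {f : N →ₗ[A] M // Function.Injective f} *
        (Nat.card (S →ₗ[A] M) - Nat.card (S →ₗ[A] N)) := by
  have : Finite (N →ₗ[A] M) := DFunLike.finite _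
  have : Finite (S →ₗ[A] M) := DFunLike.finite _
  have : Finite (S →ₗ[A] N) := DFunLike.finite _
  have := Fintype.ofFinite {f : N →ₗ[A] M // Function.Injective f}
  have e : {f : N × S →ₗ[A] M // Function.Injective f} ≃
      Σ f : {f : N →ₗ[A] M // Function.Injective f},
        {g : S →ₗ[A] M // ¬ ∃ h : S →ₗ[A] N, f.1 ∘ₗ h = g} :=
    { toFun := fun F => ⟨⟨F.1 ∘ₗ LinearMap.inl A N S, F.2.comp LinearMap.inl_injective⟩,
        ⟨F.1 ∘ₗ LinearMap.inr A N S, by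
          refine (coprod_injective_iff (F.1 ∘ₗ LinearMap.inl A N S) _
            (F.2.comp LinearMap.inl_injective)).1 ?_
          rw [LinearMap.coprod_comp_inl_inr]
          exact F.2⟩⟩
      invFun := fun p => ⟨p.1.1.coprod p.2.1, (coprod_injective_iff _ _ p.1.2).2 p.2.2⟩
      left_inv := fun F => Subtype.ext (LinearMap.coprod_comp_inl_inr F.1)
      right_inv := fun p => Sigma.subtype_ext
        (Subtype.ext (LinearMap.coprod_inl p.1.1 p.2.1)) (LinearMap.coprod_inr p.1.1 p.2.1) }
  have hcard : ∀ f : {f : N →ₗ[A] M // Function.Injective f},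
      (Nat.card {g : S →ₗ[A] M // ¬ ∃ h : S →ₗ[A] N, f.1 ∘ₗ h = g} : ℚ) =
        Nat.card (S →ₗ[A] M) - Nat.card (S →ₗ[A] N) := by
    rintro ⟨f, hf⟩
    have h1 : Nat.card {g : S →ₗ[A] M // ∃ h : S →ₗ[A] N, f ∘ₗ h = g} =
        Nat.card (S →ₗ[A] N) := by
      refine (Nat.card_congr (Equiv.ofInjective (fun h : S →ₗ[A] N => f ∘ₗ h) ?_)).symm
      intro h h' heq
      ext x
      exact hf (LinearMap.congr_fun heq x)
    have := Fintype.ofFinite (S →ₗ[A] M)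
    classical
    have h2 := Fintype.card_subtype_compl (fun g : S →ₗ[A] M => ∃ h : S →ₗ[A] N, f ∘ₗ h = g)
    have h3 := Fintype.card_subtype_le (fun g : S →ₗ[A] M => ∃ h : S →ₗ[A] N, f ∘ₗ h = g)
    rw [← h1]
    simp only [Nat.card_eq_fintype_card]
    rw [h2, Nat.cast_sub h3]
  rw [Nat.card_congr e, Nat.card_sigma, Nat.cast_sum]
  simp_rw [hcard]
  simp [Nat.card_eq_fintype_card, mul_sub]

end SimpleProduct

/-! ### Embeddings of semisimple modules -/

section SemisimpleInjections

variable {k A : Type*} [Field k] [Ring A] [Algebra k A]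

/-- `N` is the direct sum of the `S i` over the multiset `s`, built one summand at a time. By
Schur's lemma a summand `S i` changes only `Hom(S i, N)`, and `card_injective_prod` contributes one
new factor. -/
theorem exists_module_card_injective {ι : Type*} [Fintype ι] [DecidableEq ι] (S : ι → Type)
    [∀ i, AddCommGroup (S i)] [∀ i, Module k (S i)] [∀ i, Module A (S i)]
    [∀ i, IsScalarTower k A (S i)] [∀ i, Finite (S i)] [∀ i, IsSimpleModule A (S i)]
    (hS : ∀ i j, Nonempty (S i ≃ₗ[A] S j) → i = j) (s : Multiset ι) :
    ∃ (N : Type) (_ : AddCommGroup N) (_ : Module k N) (_ : Module A N)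
      (_ : IsScalarTower k A N) (_ : Finite N),
      Module.finrank k N = (s.map fun i => Module.finrank k (S i)).sum ∧
      (∀ i, Nat.card (S i →ₗ[A] N) = Nat.card (Module.End A (S i)) ^ s.count i) ∧
      ∀ (M : Type) [AddCommGroup M] [Module A M] [Finite M],
        (Nat.card {f : N →ₗ[A] M // Function.Injective f} : ℚ) =
          ∏ i, ∏ a ∈ Finset.range (s.count i),
            ((Nat.card (S i →ₗ[A] M) : ℚ) - (Nat.card (Module.End A (S i)) : ℚ) ^ a) := by
  induction s using Multiset.induction_on with
  | empty =>
    refine ⟨PUnit, inferInstance, inferInstance, inferInstance, inferInstance, inferInstance,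
      by simp [Module.finrank_zero_of_subsingleton], fun i => by simp, fun M _ _ _ => ?_⟩
    have : Unique {f : PUnit →ₗ[A] M // Function.Injective f} :=
      { default := ⟨0, Function.injective_of_subsingleton _⟩
        uniq := fun f => Subtype.ext (Subsingleton.elim _ _) }
    simp
  | cons i s ih =>
    obtain ⟨N, _, _, _, _, _, hdim, hhom, hinj⟩ := ih
    refine ⟨N × S i, inferInstance, inferInstance, inferInstance, inferInstance, inferInstance,
      ?_, fun j => ?_, fun M _ _ _ => ?_⟩
    · have : Module.Finite k N := Module.Finite.of_finite
      have : Module.Finite k (S i) := Module.Finite.of_finite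
      rw [Module.finrank_prod, hdim, Multiset.map_cons, Multiset.sum_cons, add_comm]
    · rw [← Nat.card_congr (LinearMap.prodEquiv ℕ (M := S j) (M₂ := N) (M₃ := S i)
        (R := A)).toEquiv, Nat.card_prod, hhom]
      by_cases hij : j = i
      · subst hij
        rw [Multiset.count_cons_self, pow_succ]
      · rw [Multiset.count_cons_of_ne hij]
        have : Subsingleton (S j →ₗ[A] S i) := by
          refine ⟨fun f g => ?_⟩
          have h0 : ∀ f : S j →ₗ[A] S i, f = 0 := fun f => by
            by_contra hf
            exact hij (hS j i ⟨LinearEquiv.ofBijective f (LinearMap.bijective_of_ne_zero hf)⟩)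
          rw [h0 f, h0 g]
        simp
    · rw [card_injective_prod, hinj, hhom, ← Finset.prod_erase_mul _ _ (Finset.mem_univ i),
        ← Finset.prod_erase_mul Finset.univ (fun j => ∏ a ∈ Finset.range ((i ::ₘ s).count j),
          ((Nat.card (S j →ₗ[A] M) : ℚ) - (Nat.card (Module.End A (S j)) : ℚ) ^ a))
          (Finset.mem_univ i), Multiset.count_cons_self, Finset.prod_range_succ, mul_assoc,
        Nat.cast_pow]
      congr 1
      refine Finset.prod_congr rfl fun j hj => ?_
      rw [Multiset.count_cons_of_ne (Finset.ne_of_mem_erase hj)]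

/-- The sum of `dim M + 1` copies of `S` is too large to embed in `M`, so the product formula for
its embeddings is zero; a vanishing factor provides the exponent. -/
theorem exists_card_hom_eq_pow [Finite k] (S : Type) [AddCommGroup S] [Module k S] [Module A S]
    [IsScalarTower k A S] [Finite S] [IsSimpleModule A S] (M : Type) [AddCommGroup M] [Module k M]
    [Module A M] [Finite M] :
    ∃ a ≤ Module.finrank k M, Nat.card (S →ₗ[A] M) = Nat.card (Module.End A S) ^ a := by
  obtain ⟨N, _, _, _, _, _, hdim, -, hinj⟩ := exists_module_card_injective (k := k) (A := A)
    (ι := Unit) (fun _ => S) (fun _ _ _ => rfl)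
    (Multiset.replicate (Module.finrank k M + 1) ())
  specialize hinj M
  have hS : 1 ≤ Module.finrank k S := by
    have : Module.Finite k S := Module.Finite.of_finite
    have := IsSimpleModule.nontrivial A S
    exact Module.finrank_pos
  have hempty : IsEmpty {f : N →ₗ[A] M // Function.Injective f} := by
    refine ⟨fun ⟨f, hf⟩ => ?_⟩
    have h1 := Nat.card_le_card_of_injective f hf
    rw [Module.natCard_eq_pow_finrank (K := k), Module.natCard_eq_pow_finrank (K := k) (V := M),
      Nat.pow_le_pow_iff_right Finite.one_lt_card, hdim, Multiset.map_replicate,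
      Multiset.sum_replicate, smul_eq_mul] at h1
    nlinarith
  rw [Nat.card_of_isEmpty, Nat.cast_zero, eq_comm] at hinj
  simp only [Finset.univ_unique, Finset.prod_singleton, Multiset.count_replicate_self,
    Finset.prod_eq_zero_iff, Finset.mem_range, PUnit.default_eq_unit] at hinj
  obtain ⟨a, ha, h⟩ := hinj
  exact ⟨a, by omega, by exact_mod_cast sub_eq_zero.1 h⟩

end SemisimpleInjections

/-! ### Representations of free groups as tuples of automorphisms -/

section FreeGroupReps

variable {k : Type*} [Field k] {α : Type*}

/-- A representation of a free group is a family of automorphisms. -/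
noncomputable def repEquiv (k V α : Type*) [Field k] [AddCommGroup V] [Module k V] :
    (α → (Module.End k V)ˣ) ≃ Representation k (FreeGroup α) V :=
  FreeGroup.lift.trans
    { toFun := fun f => (Units.coeHom _).comp f
      invFun := fun ρ => MonoidHom.toHomUnits ρ
      left_inv := fun _ => MonoidHom.ext fun _ => Units.ext rfl
      right_inv := fun _ => MonoidHom.ext fun _ => rfl }

@[simp]
theorem repEquiv_of {V : Type*} [AddCommGroup V] [Module k V] (γ : α → (Module.End k V)ˣ)
    (i : α) : repEquiv k V α γ (FreeGroup.of i) = γ i := by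
  simp [repEquiv]

instance {V : Type*} [AddCommGroup V] [Module k V] [Finite V] [Finite α] :
    Finite (Representation k (FreeGroup α) V) := by
  have : Finite (Module.End k V) := DFunLike.finite _
  exact Finite.of_equiv _ (repEquiv k V α)

theorem intertwines_of_generators {N V : Type*} [AddCommGroup N] [Module k N] [AddCommGroup V]
    [Module k V] (τ : Representation k (FreeGroup α) N) (ρ : Representation k (FreeGroup α) V)
    (f : N →ₗ[k] V) (h : ∀ i, f ∘ₗ τ (FreeGroup.of i) = ρ (FreeGroup.of i) ∘ₗ f)
    (g : FreeGroup α) (v : N) : f (τ g v) = ρ g (f v) := by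
  induction g using FreeGroup.induction_on generalizing v with
  | C1 => simp
  | of i => exact LinearMap.congr_fun (h i) v
  | inv_of i ih =>
    have := ih (τ (FreeGroup.of i)⁻¹ v)
    rw [Representation.self_inv_apply] at this
    rw [this, Representation.inv_self_apply]
  | mul x y hx hy => simp [hx, hy]

end FreeGroupReps

/-! ### Pairs of a representation and an embedded module -/

section CountInjections

variable {k : Type} [Field k]

/-- A linear injection `f` is a module map for the tuple `γ` exactly when `γ i ∘ f = f ∘ τ i` on
generators. For fixed `f` each equation prescribes the value of `γ i` at the point `f` of a
transitive `GL(V)`-set, hence has `s` solutions. -/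
theorem sum_card_injective_eq {m : ℕ} (N V : Type) [AddCommGroup N] [Module k N]
    [Module (MonoidAlgebra k (FreeGroup (Fin m))) N]
    [IsScalarTower k (MonoidAlgebra k (FreeGroup (Fin m))) N] [AddCommGroup V] [Module k V]
    [Finite N] [Finite V] {s : ℕ}
    (hs : Nat.card {f : N →ₗ[k] V // Function.Injective f} * s = Nat.card (Module.End k V)ˣ) :
    Nat.card (Σ ρ : Representation k (FreeGroup (Fin m)) V,
        {f : N →ₗ[MonoidAlgebra k (FreeGroup (Fin m))] ρ.asModule // Function.Injective f}) =
      Nat.card {f : N →ₗ[k] V // Function.Injective f} * s ^ m := by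
  have : Finite (Module.End k V) := DFunLike.finite _
  have : Finite (N →ₗ[k] V) := DFunLike.finite _
  have : Module.Finite k V := Module.Finite.of_finite
  let τ : Representation k (FreeGroup (Fin m)) N := Representation.ofModule' N
  have hτ : ∀ g v, τ g v = (MonoidAlgebra.single g 1 : MonoidAlgebra k _) • v := fun g v => by
    simp [τ, Representation.ofModule']
  let Y := {f : N →ₗ[k] V // Function.Injective f}
  let act : MulAction (Module.End k V)ˣ Y :=
    { smul := fun γ f => ⟨γ.1 ∘ₗ f.1,
        (LinearMap.GeneralLinearGroup.toLinearEquiv γ).injective.comp f.2⟩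
      one_smul := fun f => rfl
      mul_smul := fun γ δ f => rfl }
  let ν : Fin m → Y → Y := fun i f => ⟨f.1 ∘ₗ τ (FreeGroup.of i),
    f.2.comp (Representation.apply_bijective τ _).injective⟩
  rw [← card_tuple_smul_eq (Γ := (Module.End k V)ˣ) (Y := Y) ?_ hs m ν]
  · refine Nat.card_congr ?_
    refine ((Equiv.sigmaCongrLeft (repEquiv k V (Fin m))).symm.trans
      (Equiv.sigmaCongrRight fun γ => ?_)).trans (Equiv.subtypeProdEquivSigmaSubtype
        (fun (γ : Fin m → (Module.End k V)ˣ) (f : Y) => ∀ i, γ i • f = ν i f)).symm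
    exact
      { toFun := fun f => ⟨⟨(f.1.restrictScalars k : N →ₗ[k] (repEquiv k V (Fin m) γ).asModule),
          f.2⟩, fun i => Subtype.ext (LinearMap.ext fun v => by
            have := f.1.map_smul (MonoidAlgebra.single (FreeGroup.of i) 1) v
            rw [Representation.single_smul, one_smul, repEquiv_of, ← hτ] at this
            exact this.symm)⟩
        invFun := fun f => ⟨MonoidAlgebra.equivariantOfLinearOfComm
          ((repEquiv k V (Fin m) γ).asModuleEquiv.symm.toLinearMap ∘ₗ f.1.1) (fun g v => by
            rw [Representation.single_smul, one_smul, ← hτ]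
            refine intertwines_of_generators τ (repEquiv k V (Fin m) γ) f.1.1 (fun i => ?_) g v
            rw [repEquiv_of]
            exact (congrArg Subtype.val (f.2 i)).symm), f.1.2⟩
        left_inv := fun _ => rfl
        right_inv := fun _ => rfl }
  · rintro ⟨f, hf⟩ ⟨g, hg⟩
    obtain ⟨e, he⟩ := exists_equiv_comp_eq f g hf hg
    exact ⟨e, Subtype.ext he⟩

/-- The number of automorphisms of `k ^ n` that fix a given subspace of dimension `d`
pointwise, for `|k| = q`. -/
def stabCard {R : Type*} [CommRing R] (q : R) (n d : ℕ) : R := ∏ i ∈ Finset.Ico d n, (q ^ n - q ^ i)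

theorem stabCard_nat_pos {q : ℕ} (hq : 1 < q) (n d : ℕ) :
    0 < stabCard (q : ℚ) n d := by
  refine Finset.prod_pos fun i hi => sub_pos.2 ?_
  have : (1 : ℚ) < q := by exact_mod_cast hq
  exact pow_lt_pow_right₀ this (Finset.mem_Ico.1 hi).2

-- With `Y` the set of linear injections, `|Y| s = |GL_n|` turns `|Y| s^m` into `|GL_n| s^{m-1}`.
-- The exponent is an integer because `m = 0` is allowed.
variable [Finite k] in
theorem sum_card_injective {m n d : ℕ} (N : Type) [AddCommGroup N] [Module k N]
    [Module (MonoidAlgebra k (FreeGroup (Fin m))) N]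
    [IsScalarTower k (MonoidAlgebra k (FreeGroup (Fin m))) N] [Finite N]
    (hd : Module.finrank k N = d)
    [Fintype (Representation k (FreeGroup (Fin m)) (Fin n → k))] :
    ∑ ρ : Representation k (FreeGroup (Fin m)) (Fin n → k),
        (Nat.card {f : N →ₗ[MonoidAlgebra k (FreeGroup (Fin m))] ρ.asModule //
          Function.Injective f} : ℚ) =
      if d ≤ n then Nat.card (Module.End k (Fin n → k))ˣ *
        stabCard (Nat.card k : ℚ) n d ^ ((m : ℤ) - 1) else 0 := by
  have : Module.Finite k N := Module.Finite.of_finite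
  have hq : 1 < Nat.card k := Finite.one_lt_card
  split_ifs with hdn
  · have hn : Module.finrank k (Fin n → k) = n := by simp
    have hprod : (∏ i ∈ Finset.range d, (Nat.card k ^ n - Nat.card k ^ i)) *
        ∏ i ∈ Finset.Ico d n, (Nat.card k ^ n - Nat.card k ^ i) =
        ∏ i ∈ Finset.range n, (Nat.card k ^ n - Nat.card k ^ i) :=
      Finset.prod_range_mul_prod_Ico _ hdn
    have hcast : ((∏ i ∈ Finset.Ico d n, (Nat.card k ^ n - Nat.card k ^ i) : ℕ) : ℚ) =
        stabCard (Nat.card k : ℚ) n d := by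
      rw [stabCard, Nat.cast_prod]
      refine Finset.prod_congr rfl fun i hi => ?_
      rw [Nat.cast_sub (Nat.pow_le_pow_right hq.le (Finset.mem_Ico.1 hi).2.le)]
      simp
    rw [← card_injective_linearMap hd hn hdn, ← card_units_end hn] at hprod
    have h := sum_card_injective_eq (m := m) N (Fin n → k) hprod
    have hfin : ∀ ρ : Representation k (FreeGroup (Fin m)) (Fin n → k),
        Finite {f : N →ₗ[MonoidAlgebra k (FreeGroup (Fin m))] ρ.asModule //
          Function.Injective f} := fun ρ => by
      have : Finite ρ.asModule := inferInstanceAs (Finite (Fin n → k))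
      have : Finite (N →ₗ[MonoidAlgebra k (FreeGroup (Fin m))] ρ.asModule) := DFunLike.finite _
      infer_instance
    rw [Nat.card_sigma] at h
    have hs := (stabCard_nat_pos hq n d).ne'
    rw [zpow_sub₀ hs, zpow_natCast, zpow_one, ← hprod, ← Nat.cast_sum, h, ← hcast]
    rw [← hcast] at hs
    push_cast at hs ⊢
    field_simp
  · refine Finset.sum_eq_zero fun ρ _ => ?_
    rw [Nat.cast_eq_zero, Nat.card_eq_zero]
    refine Or.inl ⟨fun ⟨f, hf⟩ => hdn ?_⟩
    have := LinearMap.finrank_le_finrank_of_injective (f := f.restrictScalars k) hf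
    rw [hd] at this
    exact this.trans_eq ((LinearEquiv.finrank_eq ρ.asModuleEquiv).trans (by simp))

end CountInjections

/-! ### Coefficients of finite products of power series -/

section EulerProduct

theorem coeff_prod_congr {ι R : Type*} [CommRing R] (s : Finset ι) (f g : ι → R⟦X⟧) (n : ℕ)
    (h : ∀ i ∈ s, ∀ j ≤ n, PowerSeries.coeff j (f i) = PowerSeries.coeff j (g i)) :
    PowerSeries.coeff n (∏ i ∈ s, f i) = PowerSeries.coeff n (∏ i ∈ s, g i) := by
  classical
  rw [PowerSeries.coeff_prod, PowerSeries.coeff_prod]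
  refine Finset.sum_congr rfl fun l hl => Finset.prod_congr rfl fun i hi => h i hi _ ?_
  rw [Finset.mem_finsuppAntidiag] at hl
  rw [← hl.1]
  exact Finset.single_le_sum (f := fun i => l i) (fun _ _ => Nat.zero_le _) hi

theorem coeff_prod_expand {ι : Type*} [Fintype ι] [DecidableEq ι] (e : ι → ℕ)
    (he : ∀ i, e i ≠ 0) (c : ι → ℕ → ℚ) {d n : ℕ} (hdn : d ≤ n) :
    PowerSeries.coeff d (∏ i, PowerSeries.expand (e i) (he i) (PowerSeries.mk (c i))) =
      ∑ p ∈ Fintype.piFinset (fun _ : ι => Finset.range (n + 1)),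
        if ∑ i, p i * e i = d then ∏ i, c i (p i) else 0 := by
  -- As every `e i ≥ 1` and `d ≤ n`, each factor may be truncated after `n + 1` terms. The cutoff
  -- depends on `n` and not on `d`, so one index set serves all `d ≤ n`.
  rw [coeff_prod_congr _ _ (fun i => ∑ j ∈ Finset.range (n + 1),
    PowerSeries.C (c i j) * PowerSeries.X ^ (j * e i))]
  · rw [Finset.prod_univ_sum, map_sum]
    refine Finset.sum_congr rfl fun p _ => ?_
    rw [Finset.prod_mul_distrib, Finset.prod_pow_eq_pow_sum, ← map_prod,
      PowerSeries.coeff_C_mul_X_pow]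
    simp only [eq_comm]
  · intro i _ j hj
    rw [PowerSeries.coeff_expand, map_sum]
    simp only [PowerSeries.coeff_C_mul_X_pow, PowerSeries.coeff_mk]
    split_ifs with h
    · obtain ⟨l, rfl⟩ := h
      have hpos := Nat.pos_of_ne_zero (he i)
      rw [Nat.mul_div_cancel_left _ hpos, Finset.sum_eq_single l]
      · rw [if_pos (mul_comm _ _)]
      · intro b _ hb
        rw [if_neg]
        rw [mul_comm b]
        exact fun h => hb (Nat.eq_of_mul_eq_mul_left hpos h).symm
      · intro hl
        exfalso
        apply hl
        rw [Finset.mem_range]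
        nlinarith
    · refine (Finset.sum_eq_zero fun b _ => if_neg ?_).symm
      rintro rfl
      exact h (dvd_mul_left _ _)

end EulerProduct

/-! ### Irreducible representations of bounded dimension -/

section IrreducibleClasses

/-- Irreducible representations of the free group `F_m` on `k ^ d`. -/
abbrev IrrRep (m d : ℕ) (k : Type) [Field k] : Type :=
  {ρ : Representation k (FreeGroup (Fin m)) (Fin d → k) // ρ.IsIrreducible}

/-- Isomorphism of irreducible representations. -/
instance irrSetoid (m d : ℕ) (k : Type) [Field k] : Setoid (IrrRep m d k) where
  r ρ σ := Nonempty (Representation.Equiv ρ.1 σ.1)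
  iseqv :=
    { refl := fun ρ => ⟨Representation.Equiv.refl ρ.1⟩
      symm := fun ⟨e⟩ => ⟨e.symm⟩
      trans := fun ⟨e⟩ ⟨f⟩ => ⟨e.trans f⟩ }

/-- Isomorphism classes of irreducible representations of `F_m` of dimension at most `D`. -/
abbrev IrrIndex (m D : ℕ) (k : Type) [Field k] : Type :=
  Σ d : Fin (D + 1), Quotient (irrSetoid m d k)

instance (m D : ℕ) (k : Type) [Field k] [Finite k] : Finite (IrrIndex m D k) := by
  have : ∀ d : Fin (D + 1), Finite (Quotient (irrSetoid m d k)) := fun d => Quotient.finite _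
  infer_instance

noncomputable instance (m D : ℕ) (k : Type) [Field k] [Finite k] : Fintype (IrrIndex m D k) :=
  Fintype.ofFinite _

noncomputable instance (m D : ℕ) (k : Type) [Field k] : DecidableEq (IrrIndex m D k) :=
  Classical.decEq _

variable {m D : ℕ} {k : Type} [Field k]

/-- A representative of an isomorphism class. -/
noncomputable def irrRep (i : IrrIndex m D k) :
    Representation k (FreeGroup (Fin m)) (Fin i.1 → k) :=
  i.2.out.1

instance (i : IrrIndex m D k) : (irrRep i).IsIrreducible := i.2.out.2

/-- The dimension of an irreducible representation. -/
def irrDim (i : IrrIndex m D k) : ℕ := i.1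

/-- The order of the endomorphism field of an irreducible representation. -/
noncomputable def irrEndCard (i : IrrIndex m D k) : ℕ :=
  Nat.card (Module.End (MonoidAlgebra k (FreeGroup (Fin m))) (irrRep i).asModule)

instance [Finite k] (i : IrrIndex m D k) : Finite (irrRep i).asModule :=
  inferInstanceAs (Finite (Fin i.1 → k))

instance [Finite k] {n : ℕ} (ρ : Representation k (FreeGroup (Fin m)) (Fin n → k)) :
    Finite ρ.asModule :=
  inferInstanceAs (Finite (Fin n → k))

theorem finrank_asModule {n : ℕ} (ρ : Representation k (FreeGroup (Fin m)) (Fin n → k)) :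
    Module.finrank k ρ.asModule = n :=
  (LinearEquiv.finrank_eq ρ.asModuleEquiv).trans (by simp)

theorem irrDim_ne_zero (i : IrrIndex m D k) : irrDim i ≠ 0 := by
  have := IsSimpleModule.nontrivial (MonoidAlgebra k (FreeGroup (Fin m))) (irrRep i).asModule
  have h : 0 < Module.finrank k (irrRep i).asModule := Module.finrank_pos
  rw [finrank_asModule] at h
  exact h.ne'

theorem one_lt_irrEndCard [Finite k] (i : IrrIndex m D k) : 1 < irrEndCard i := by
  have := IsSimpleModule.nontrivial (MonoidAlgebra k (FreeGroup (Fin m))) (irrRep i).asModule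
  have : Finite (Module.End (MonoidAlgebra k (FreeGroup (Fin m))) (irrRep i).asModule) :=
    DFunLike.finite _
  exact Finite.one_lt_card

/-- Representations with isomorphic modules are isomorphic. -/
theorem nonempty_equiv_iff {G V W : Type*} [Group G] [AddCommGroup V] [Module k V]
    [AddCommGroup W] [Module k W] (ρ : Representation k G V) (σ : Representation k G W) :
    Nonempty (Representation.Equiv ρ σ) ↔
      Nonempty (ρ.asModule ≃ₗ[MonoidAlgebra k G] σ.asModule) := by
  constructor
  · rintro ⟨e⟩
    exact ⟨LinearEquiv.ofBijective
      (Representation.IntertwiningMap.equivLinearMapAsModule ρ σ e.toIntertwiningMap)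
      e.toLinearEquiv.bijective⟩
  · rintro ⟨e⟩
    let f := (Representation.IntertwiningMap.equivLinearMapAsModule ρ σ).symm e.toLinearMap
    exact ⟨Representation.Equiv.mk (LinearEquiv.ofBijective f.toLinearMap e.bijective)
      f.isIntertwining'⟩

theorem irrRep_injective (i j : IrrIndex m D k)
    (h : Nonempty ((irrRep i).asModule ≃ₗ[MonoidAlgebra k (FreeGroup (Fin m))]
      (irrRep j).asModule)) : i = j := by
  have hd : i.1 = j.1 := by
    obtain ⟨e⟩ := h
    have := (e.restrictScalars k).finrank_eq
    rw [finrank_asModule, finrank_asModule] at this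
    exact Fin.ext this
  obtain ⟨d, x⟩ := i
  obtain ⟨d', y⟩ := j
  obtain rfl : d = d' := hd
  have : x.out ≈ y.out := (nonempty_equiv_iff _ _).2 h
  rw [Quotient.out_equiv_out] at this
  rw [this]

/-- Coordinates with respect to a basis move `T` to `k^d`, where it has a chosen representative. -/
theorem exists_irrRep_equiv (T : Type) [AddCommGroup T] [Module k T]
    [Module (MonoidAlgebra k (FreeGroup (Fin m))) T]
    [IsScalarTower k (MonoidAlgebra k (FreeGroup (Fin m))) T] [Module.Finite k T]
    [IsSimpleModule (MonoidAlgebra k (FreeGroup (Fin m))) T] (hD : Module.finrank k T ≤ D) :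
    ∃ i : IrrIndex m D k,
      Nonempty (T ≃ₗ[MonoidAlgebra k (FreeGroup (Fin m))] (irrRep i).asModule) := by
  set d := Module.finrank k T with hd
  let e : T ≃ₗ[k] (Fin d → k) := (Module.finBasis k T).equivFun
  let ρ : Representation k (FreeGroup (Fin m)) (Fin d → k) :=
    (e.conjAlgEquiv k : Module.End k T →* Module.End k (Fin d → k)).comp
      (Representation.ofModule' T)
  let E : T ≃ₗ[MonoidAlgebra k (FreeGroup (Fin m))] ρ.asModule :=
    LinearEquiv.ofBijective
      (MonoidAlgebra.equivariantOfLinearOfComm (ρ.asModuleEquiv.symm.toLinearMap ∘ₗ e.toLinearMap)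
        (fun g v => by
          rw [Representation.single_smul, one_smul]
          change e ((MonoidAlgebra.single g 1 : MonoidAlgebra k (FreeGroup (Fin m))) • v) =
            e ((MonoidAlgebra.single g 1 : MonoidAlgebra k (FreeGroup (Fin m))) • e.symm (e v))
          rw [e.symm_apply_apply]))
      e.bijective
  have hsimple : IsSimpleModule (MonoidAlgebra k (FreeGroup (Fin m))) ρ.asModule :=
    IsSimpleModule.congr E.symm
  have hirr : ρ.IsIrreducible := ρ.irreducible_iff_isSimpleModule_asModule.2 hsimple
  refine ⟨⟨⟨d, by omega⟩, ⟦⟨ρ, hirr⟩⟧⟩, ?_⟩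
  have : (⟨ρ, hirr⟩ : IrrRep m d k) ≈ (⟦⟨ρ, hirr⟩⟧ : Quotient (irrSetoid m d k)).out :=
    Setoid.symm (Quotient.mk_out _)
  obtain ⟨F⟩ := (nonempty_equiv_iff _ _).1 this
  exact ⟨E.trans F⟩

end IrreducibleClasses

/-! ### The recursion for the product over irreducible representations -/

section Recursion

variable {k : Type} [Field k] [Finite k] {m D : ℕ}

/-- A nonzero finite module has a simple submodule `T`. Its inclusion is a nonzero homomorphism,
which excludes the exponent `0`. -/
theorem exists_irr_card_hom {n : ℕ} (hn : 1 ≤ n) (hD : n ≤ D)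
    (ρ : Representation k (FreeGroup (Fin m)) (Fin n → k)) :
    ∃ i : IrrIndex m D k, ∃ a, 1 ≤ a ∧ a ≤ n ∧
      Nat.card ((irrRep i).asModule →ₗ[MonoidAlgebra k (FreeGroup (Fin m))] ρ.asModule) =
        irrEndCard i ^ a := by
  have hfr := finrank_asModule ρ
  have : Nontrivial ρ.asModule := Module.nontrivial_of_finrank_pos (R := k) (by omega)
  have : Finite (Submodule (MonoidAlgebra k (FreeGroup (Fin m))) ρ.asModule) :=
    Finite.of_injective (fun N => (N : Set ρ.asModule)) SetLike.coe_injective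
  obtain ⟨T, hT⟩ := IsAtomic.exists_atom
    (Submodule (MonoidAlgebra k (FreeGroup (Fin m))) ρ.asModule)
  have := isSimpleModule_iff_isAtom.2 hT
  obtain ⟨i, ⟨e⟩⟩ := exists_irrRep_equiv (k := k) (m := m) (D := D) T
    ((Submodule.finrank_le (T.restrictScalars k)).trans (by omega))
  obtain ⟨a, ha, h⟩ := exists_card_hom_eq_pow (k := k)
    (A := MonoidAlgebra k (FreeGroup (Fin m))) (irrRep i).asModule ρ.asModule
  refine ⟨i, a, ?_, by omega, h⟩
  by_contra ha0
  obtain rfl : a = 0 := by omega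
  rw [pow_zero] at h
  have := (Nat.card_eq_one_iff_unique.1 h).1
  have h0 := Subsingleton.elim (T.subtype ∘ₗ e.symm.toLinearMap) 0
  have hT' := IsSimpleModule.nontrivial (MonoidAlgebra k (FreeGroup (Fin m))) T
  obtain ⟨t, ht⟩ := exists_ne (0 : T)
  have := LinearMap.congr_fun h0 (e t)
  exact ht (by simpa using this)

/-- The product over irreducible representations `S` of dimension at most `D` of the series
`∑_j t ^ (j dim S) / ∏_{i=1}^j (1 - |End S| ^ i)`. -/
noncomputable def irrProduct (m D : ℕ) (k : Type) [Field k] [Finite k] : ℚ⟦X⟧ :=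
  ∏ i : IrrIndex m D k, PowerSeries.expand (irrDim i) (irrDim_ne_zero i)
    (PowerSeries.mk (eulerCoeff (irrEndCard i)))

/-- Count weighted triples of a representation `ρ` on `k^n`, a semisimple `N` with multiplicities
`p`, and an embedding of `N` in `ρ`. For fixed `ρ` the total is zero by Möbius inversion; for fixed
`N` it depends only on `dim N`. The cutoff `D ≥ n` keeps the product finite and loses no constituent
of `ρ`. -/
theorem sum_coeff_irrProduct {n : ℕ} (hn : 1 ≤ n) (hD : n ≤ D) :
    ∑ d ∈ Finset.range (n + 1), PowerSeries.coeff d (irrProduct m D k) *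
      stabCard (Nat.card k : ℚ) n d ^ ((m : ℤ) - 1) = 0 := by
  have := Fintype.ofFinite (Representation k (FreeGroup (Fin m)) (Fin n → k))
  have hQ : ∀ i : IrrIndex m D k, (1 : ℚ) < irrEndCard i := fun i => by
    exact_mod_cast one_lt_irrEndCard i
  let H : Representation k (FreeGroup (Fin m)) (Fin n → k) → IrrIndex m D k → ℚ := fun ρ i =>
    Nat.card ((irrRep i).asModule →ₗ[MonoidAlgebra k (FreeGroup (Fin m))] ρ.asModule)
  have hzero : ∀ ρ, ∏ i, ∑ j ∈ Finset.range (n + 1),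
      eulerCoeff (irrEndCard i) j * ∏ a ∈ Finset.range j, (H ρ i - (irrEndCard i : ℚ) ^ a) = 0 := by
    intro ρ
    obtain ⟨i, a, ha, han, h⟩ := exists_irr_card_hom hn hD ρ
    refine Finset.prod_eq_zero (Finset.mem_univ i) ?_
    have hH : H ρ i = (irrEndCard i : ℚ) ^ a := by simp only [H, h]; push_cast; rfl
    rw [hH]
    exact sum_eulerCoeff_mul_prod_eq_zero (hQ i) ha han
  let P := Fintype.piFinset (fun _ : IrrIndex m D k => Finset.range (n + 1))
  let dim : (IrrIndex m D k → ℕ) → ℕ := fun p => ∑ i, p i * irrDim i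
  have hsum : ∀ p : IrrIndex m D k → ℕ, ∑ ρ, ∏ i, ∏ a ∈ Finset.range (p i),
      (H ρ i - (irrEndCard i : ℚ) ^ a) = if dim p ≤ n then
        (Nat.card (Module.End k (Fin n → k))ˣ : ℚ) *
        stabCard (Nat.card k : ℚ) n (dim p) ^ ((m : ℤ) - 1) else 0 := by
    intro p
    obtain ⟨N, _, _, _, _, _, hdim, -, hinj⟩ := exists_module_card_injective (k := k)
      (A := MonoidAlgebra k (FreeGroup (Fin m)))
      (fun i : IrrIndex m D k => (irrRep i).asModule) irrRep_injective
      (Finsupp.toMultiset (Finsupp.equivFunOnFinite.symm p))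
    have hdim' : Module.finrank k N = dim p := by
      rw [hdim, Finset.sum_multiset_map_count]
      simp only [finrank_asModule, Finsupp.count_toMultiset, smul_eq_mul]
      refine Finset.sum_subset (Finset.subset_univ _) fun i _ hi => ?_
      have : Finsupp.equivFunOnFinite.symm p i = 0 := by simpa using hi
      rw [this, zero_mul]
    rw [← sum_card_injective N hdim']
    refine Finset.sum_congr rfl fun ρ _ => ?_
    rw [hinj ρ.asModule]
    simp [Finsupp.count_toMultiset, H, irrEndCard]
  -- Exchange the sums over `p` and `ρ`: for fixed `ρ` the sum over `p` is the expanded product in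
  -- `hzero`.
  have htotal : ∑ p ∈ P, (∏ i, eulerCoeff (irrEndCard i) (p i)) * (if dim p ≤ n then
        (Nat.card (Module.End k (Fin n → k))ˣ : ℚ) *
        stabCard (Nat.card k : ℚ) n (dim p) ^ ((m : ℤ) - 1) else 0) = 0 := by
    simp_rw [← hsum, Finset.mul_sum]
    rw [Finset.sum_comm]
    refine Finset.sum_eq_zero fun ρ _ => ?_
    rw [← hzero ρ, Finset.prod_univ_sum]
    simp_rw [Finset.prod_mul_distrib]
    rfl
  have hGL : (Nat.card (Module.End k (Fin n → k))ˣ : ℚ) ≠ 0 := by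
    have : Finite (Module.End k (Fin n → k)) := DFunLike.finite _
    exact_mod_cast Nat.card_pos.ne'
  refine (mul_eq_zero.1 (Eq.trans ?_ htotal)).resolve_left hGL
  have hcoeff : ∀ d ∈ Finset.range (n + 1), PowerSeries.coeff d (irrProduct m D k) *
      stabCard (Nat.card k : ℚ) n d ^ ((m : ℤ) - 1) = ∑ p ∈ P, if dim p = d then
        (∏ i, eulerCoeff (irrEndCard i) (p i)) *
          stabCard (Nat.card k : ℚ) n (dim p) ^ ((m : ℤ) - 1) else 0 := by
    intro d hd
    rw [irrProduct, coeff_prod_expand irrDim irrDim_ne_zero _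
      (Nat.lt_succ_iff.1 (Finset.mem_range.1 hd)), Finset.sum_mul]
    refine Finset.sum_congr rfl fun p _ => ?_
    rw [ite_mul, zero_mul]
    by_cases h : dim p = d
    · rw [if_pos h, if_pos h, h]
    · rw [if_neg h, if_neg h]
  rw [Finset.sum_congr rfl hcoeff, Finset.sum_comm, Finset.mul_sum]
  refine Finset.sum_congr rfl fun p _ => ?_
  rw [Finset.sum_ite_eq]
  simp only [Finset.mem_range, Nat.lt_succ_iff]
  split_ifs <;> ring

end Recursion

/-! ### The Euler derivation -/

section EulerDerivation

variable {R : Type*} [CommRing R]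

/-- The Euler derivation `t d/dt` on power series. -/
noncomputable def eulerDeriv (f : R⟦X⟧) : R⟦X⟧ := PowerSeries.X * PowerSeries.derivative R f

@[simp]
theorem coeff_eulerDeriv (f : R⟦X⟧) (n : ℕ) :
    PowerSeries.coeff n (eulerDeriv f) = n * PowerSeries.coeff n f := by
  cases n with
  | zero => simp [eulerDeriv]
  | succ n =>
    rw [eulerDeriv, PowerSeries.coeff_succ_X_mul, PowerSeries.coeff_derivative]
    push_cast
    ring

theorem eulerDeriv_mul (f g : R⟦X⟧) :
    eulerDeriv (f * g) = eulerDeriv f * g + f * eulerDeriv g := by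
  simp only [eulerDeriv, Derivation.leibniz, smul_eq_mul]
  ring

@[simp]
theorem eulerDeriv_one : eulerDeriv (1 : R⟦X⟧) = 0 := by
  simp [eulerDeriv]

theorem eulerDeriv_rescale (c : R) (f : R⟦X⟧) :
    eulerDeriv (PowerSeries.rescale c f) = PowerSeries.rescale c (eulerDeriv f) := by
  ext n
  simp only [coeff_eulerDeriv, PowerSeries.coeff_rescale]
  ring

theorem eulerDeriv_expand (d : ℕ) (hd : d ≠ 0) (f : R⟦X⟧) :
    eulerDeriv (PowerSeries.expand d hd f) =
      (d : R⟦X⟧) * PowerSeries.expand d hd (eulerDeriv f) := by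
  ext n
  rw [← map_natCast (PowerSeries.C (R := R)), PowerSeries.coeff_C_mul]
  simp only [coeff_eulerDeriv, PowerSeries.coeff_expand]
  split_ifs with h
  · obtain ⟨l, rfl⟩ := h
    rw [Nat.mul_div_cancel_left _ (Nat.pos_of_ne_zero hd)]
    push_cast
    ring
  · simp

theorem eulerDeriv_prod {ι : Type*} (s : Finset ι) (f u : ι → R⟦X⟧)
    (h : ∀ i ∈ s, eulerDeriv (f i) = u i * f i) :
    eulerDeriv (∏ i ∈ s, f i) = (∑ i ∈ s, u i) * ∏ i ∈ s, f i := by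
  classical
  induction s using Finset.induction_on with
  | empty => simp
  | insert i s hi ih =>
    rw [Finset.prod_insert hi, Finset.sum_insert hi, eulerDeriv_mul,
      h i (Finset.mem_insert_self _ _), ih fun j hj => h j (Finset.mem_insert_of_mem hj)]
    ring

end EulerDerivation

/-! ### Logarithmic derivatives of the Euler factors -/

section EulerSeries

theorem eulerCoeff_succ (Q : ℚ) (n : ℕ) :
    eulerCoeff Q (n + 1) = eulerCoeff Q n * (1 - Q ^ (n + 1))⁻¹ := by
  rw [eulerCoeff, eulerCoeff, Finset.prod_range_succ]

/-- The functional equation `f(Qt) = (1 - t) f(t)` is the relation `c_n (1 - Q^n) = c_{n-1}` for the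
coefficients. -/
theorem rescale_mk_eulerCoeff {Q : ℚ} (hQ : 1 < Q) :
    PowerSeries.rescale Q (PowerSeries.mk (eulerCoeff Q)) =
      (1 - PowerSeries.X) * PowerSeries.mk (eulerCoeff Q) := by
  ext n
  rw [sub_mul, one_mul, map_sub, PowerSeries.coeff_rescale]
  cases n with
  | zero => simp
  | succ n =>
    rw [PowerSeries.coeff_succ_X_mul, PowerSeries.coeff_mk, PowerSeries.coeff_mk, eulerCoeff_succ]
    field_simp [one_sub_pow_ne_zero hQ n]
    ring

/-- The logarithmic derivative of `∑_j t ^ j / ∏_{i=1}^j (1 - Q ^ i)`. -/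
theorem eulerDeriv_mk_eulerCoeff {Q : ℚ} (hQ : 1 < Q) :
    eulerDeriv (PowerSeries.mk (eulerCoeff Q)) =
      PowerSeries.mk (fun n => if n = 0 then 0 else (1 - Q ^ n)⁻¹) *
        PowerSeries.mk (eulerCoeff Q) := by
  set f := PowerSeries.mk (eulerCoeff Q) with hf
  have hf0 : PowerSeries.constantCoeff f ≠ 0 := by
    rw [← PowerSeries.coeff_zero_eq_constantCoeff_apply, hf, PowerSeries.coeff_mk]
    simp [eulerCoeff]
  have hfne : f ≠ 0 := fun h => hf0 (by rw [h, map_zero])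
  set u := eulerDeriv f * f⁻¹ with hu
  have huf : eulerDeriv f = u * f := by
    rw [hu, mul_assoc, PowerSeries.inv_mul_cancel _ hf0, mul_one]
  have h1 := congrArg eulerDeriv (rescale_mk_eulerCoeff hQ)
  rw [← hf, eulerDeriv_rescale, eulerDeriv_mul, huf, map_mul, rescale_mk_eulerCoeff hQ, ← hf] at h1
  have hX : eulerDeriv (1 - PowerSeries.X : ℚ⟦X⟧) = -PowerSeries.X := by
    simp [eulerDeriv]
  rw [hX] at h1
  -- The logarithmic derivative of the functional equation is `u(Qt) - u(t) = -t/(1 - t)`, so `(Q^n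
  -- - 1) u_n = -1` for `n ≥ 1`.
  have h2 : (1 - PowerSeries.X) * (PowerSeries.rescale Q u - u) = -PowerSeries.X :=
    mul_right_cancel₀ hfne (by linear_combination h1)
  have h3 : PowerSeries.rescale Q u - u = -PowerSeries.X * PowerSeries.mk 1 := by
    rw [← h2, mul_right_comm, mul_comm (1 - PowerSeries.X),
      PowerSeries.mk_one_mul_one_sub_eq_one, one_mul]
  rw [huf]
  congr 1
  ext n
  have h4 := congrArg (PowerSeries.coeff n) h3
  cases n with
  | zero => rw [PowerSeries.coeff_mk, if_pos rfl, hu]; simp [eulerDeriv]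
  | succ n =>
    rw [map_sub, PowerSeries.coeff_rescale, neg_mul, map_neg, PowerSeries.coeff_succ_X_mul,
      PowerSeries.coeff_mk, Pi.one_apply] at h4
    rw [PowerSeries.coeff_mk, if_neg n.succ_ne_zero]
    refine eq_inv_of_mul_eq_one_left ?_
    linear_combination -h4

/-- The coefficients of the logarithmic derivative of `irrProduct`. -/
noncomputable def irrLogCoeff (m D : ℕ) (k : Type) [Field k] [Finite k] (n : ℕ) : ℚ :=
  ∑ i : IrrIndex m D k, if irrDim i ∣ n ∧ n ≠ 0 then
    irrDim i * (1 - (irrEndCard i : ℚ) ^ (n / irrDim i))⁻¹ else 0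

theorem eulerDeriv_irrProduct (m D : ℕ) (k : Type) [Field k] [Finite k] :
    eulerDeriv (irrProduct m D k) = PowerSeries.mk (irrLogCoeff m D k) * irrProduct m D k := by
  rw [irrProduct, eulerDeriv_prod _ _ (fun i : IrrIndex m D k => (irrDim i : ℚ⟦X⟧) *
    PowerSeries.expand (irrDim i) (irrDim_ne_zero i)
      (PowerSeries.mk (fun n => if n = 0 then 0 else (1 - (irrEndCard i : ℚ) ^ n)⁻¹)))]
  · congr 1
    ext n
    rw [map_sum, PowerSeries.coeff_mk, irrLogCoeff]
    refine Finset.sum_congr rfl fun i _ => ?_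
    rw [← map_natCast (PowerSeries.C (R := ℚ)), PowerSeries.coeff_C_mul, PowerSeries.coeff_expand]
    by_cases h : irrDim i ∣ n
    · obtain ⟨l, rfl⟩ := h
      have := irrDim_ne_zero i
      rw [if_pos (dvd_mul_right _ _), Nat.mul_div_cancel_left _ (Nat.pos_of_ne_zero this)]
      by_cases hl : l = 0
      · simp [hl]
      · simp [hl, this]
    · simp [h]
  · intro i _
    rw [eulerDeriv_expand, eulerDeriv_mk_eulerCoeff (by exact_mod_cast one_lt_irrEndCard i),
      map_mul, mul_assoc]

theorem coeff_zero_irrProduct (m D : ℕ) (k : Type) [Field k] [Finite k] :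
    PowerSeries.coeff 0 (irrProduct m D k) = 1 := by
  rw [irrProduct, PowerSeries.coeff_zero_eq_constantCoeff, map_prod]
  refine Finset.prod_eq_one fun i _ => ?_
  rw [PowerSeries.constantCoeff_expand, ← PowerSeries.coeff_zero_eq_constantCoeff_apply,
    PowerSeries.coeff_mk]
  simp [eulerCoeff]

end EulerSeries

/-! ### Values of rational functions at a point -/

section Values

/-- The rational function `r` is defined at `a`, with value `v`. -/
def HasVal (a : ℚ) (r : RatFunc ℚ) (v : ℚ) : Prop :=
  ∃ p d : ℚ[X], d.eval a ≠ 0 ∧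
    r * algebraMap ℚ[X] (RatFunc ℚ) d = algebraMap ℚ[X] (RatFunc ℚ) p ∧ p.eval a = v * d.eval a

namespace HasVal

variable {a v w : ℚ} {r r' : RatFunc ℚ}

theorem ofPolynomial (p : ℚ[X]) : HasVal a (algebraMap ℚ[X] (RatFunc ℚ) p) (p.eval a) :=
  ⟨p, 1, by simp, by simp, by simp⟩

theorem X : HasVal a RatFunc.X a := by
  simpa using HasVal.ofPolynomial (a := a) Polynomial.X

theorem natCast (n : ℕ) : HasVal a n n := by
  simpa using HasVal.ofPolynomial (a := a) (n : ℚ[X])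

theorem one : HasVal a 1 1 := by simpa using natCast (a := a) 1

theorem zero : HasVal a 0 0 := by simpa using natCast (a := a) 0

theorem add (h : HasVal a r v) (h' : HasVal a r' w) : HasVal a (r + r') (v + w) := by
  obtain ⟨p, d, hd, hr, hv⟩ := h
  obtain ⟨p', d', hd', hr', hv'⟩ := h'
  refine ⟨p * d' + p' * d, d * d', by simp [hd, hd'], ?_, ?_⟩
  · simp only [map_mul, map_add, ← hr, ← hr']; ring
  · simp only [eval_add, eval_mul, hv, hv']; ring

theorem mul (h : HasVal a r v) (h' : HasVal a r' w) : HasVal a (r * r') (v * w) := by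
  obtain ⟨p, d, hd, hr, hv⟩ := h
  obtain ⟨p', d', hd', hr', hv'⟩ := h'
  refine ⟨p * p', d * d', by simp [hd, hd'], ?_, ?_⟩
  · simp only [map_mul, ← hr, ← hr']; ring
  · simp only [eval_mul, hv, hv']; ring

theorem neg (h : HasVal a r v) : HasVal a (-r) (-v) := by
  obtain ⟨p, d, hd, hr, hv⟩ := h
  exact ⟨-p, d, hd, by rw [map_neg, ← hr]; ring, by rw [eval_neg, hv]; ring⟩

theorem sub (h : HasVal a r v) (h' : HasVal a r' w) : HasVal a (r - r') (v - w) := by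
  simpa only [sub_eq_add_neg] using h.add h'.neg

theorem inv (h : HasVal a r v) (hv0 : v ≠ 0) : HasVal a r⁻¹ v⁻¹ := by
  obtain ⟨p, d, hd, hr, hv⟩ := h
  have hp : p.eval a ≠ 0 := by rw [hv]; exact mul_ne_zero hv0 hd
  have hp0 : algebraMap ℚ[X] (RatFunc ℚ) p ≠ 0 := fun h0 => hp (by
    rw [(map_eq_zero_iff _ (RatFunc.algebraMap_injective ℚ)).1 h0, eval_zero])
  have hr0 : r ≠ 0 := by rintro rfl; exact hp0 (by rw [← hr, zero_mul])
  refine ⟨d, p, hp, ?_, ?_⟩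
  · rw [← hr, inv_mul_cancel_left₀ hr0]
  · rw [hv, inv_mul_cancel_left₀ hv0]

theorem div (h : HasVal a r v) (h' : HasVal a r' w) (hw : w ≠ 0) : HasVal a (r / r') (v / w) := by
  simpa only [div_eq_mul_inv] using h.mul (h'.inv hw)

theorem pow (h : HasVal a r v) (n : ℕ) : HasVal a (r ^ n) (v ^ n) := by
  induction n with
  | zero => simpa using one
  | succ n ih => simpa only [pow_succ] using ih.mul h

theorem zpow (h : HasVal a r v) (hv : v ≠ 0) (n : ℤ) : HasVal a (r ^ n) (v ^ n) := by
  cases n with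
  | ofNat n => simpa using h.pow n
  | negSucc n => simpa only [zpow_negSucc] using (h.pow (n + 1)).inv (pow_ne_zero _ hv)

theorem sum {ι : Type*} (s : Finset ι) (f : ι → RatFunc ℚ) (g : ι → ℚ)
    (h : ∀ i ∈ s, HasVal a (f i) (g i)) : HasVal a (∑ i ∈ s, f i) (∑ i ∈ s, g i) := by
  classical
  induction s using Finset.induction_on with
  | empty => simpa using zero
  | insert i s hi ih =>
    rw [Finset.sum_insert hi, Finset.sum_insert hi]
    exact (h i (Finset.mem_insert_self _ _)).add
      (ih fun j hj => h j (Finset.mem_insert_of_mem hj))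

theorem prod {ι : Type*} (s : Finset ι) (f : ι → RatFunc ℚ) (g : ι → ℚ)
    (h : ∀ i ∈ s, HasVal a (f i) (g i)) : HasVal a (∏ i ∈ s, f i) (∏ i ∈ s, g i) := by
  classical
  induction s using Finset.induction_on with
  | empty => simpa using one
  | insert i s hi ih =>
    rw [Finset.prod_insert hi, Finset.prod_insert hi]
    exact (h i (Finset.mem_insert_self _ _)).mul
      (ih fun j hj => h j (Finset.mem_insert_of_mem hj))

theorem denom_eval_ne_zero (h : HasVal a r v) : r.denom.eval a ≠ 0 := by
  obtain ⟨p, d, hd, hr, -⟩ := h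
  have hd0 : d ≠ 0 := by rintro rfl; simp at hd
  have hd1 : algebraMap ℚ[X] (RatFunc ℚ) d ≠ 0 := RatFunc.algebraMap_ne_zero hd0
  obtain ⟨e, he⟩ := (RatFunc.denom_dvd hd0).2 ⟨p, (eq_div_iff hd1).2 hr⟩
  rw [he, eval_mul] at hd
  exact left_ne_zero_of_mul hd

theorem num_eval (h : HasVal a r v) : r.num.eval a = v * r.denom.eval a := by
  obtain ⟨p, d, hd, hr, hv⟩ := h
  have hd0 : d ≠ 0 := by rintro rfl; simp at hd
  have hd1 : algebraMap ℚ[X] (RatFunc ℚ) d ≠ 0 := RatFunc.algebraMap_ne_zero hd0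
  have h := congrArg (Polynomial.eval a)
    ((RatFunc.num_mul_eq_mul_denom_iff hd0).2 ((eq_div_iff hd1).2 hr))
  rw [eval_mul, eval_mul, hv] at h
  exact mul_right_cancel₀ hd (by linear_combination h)

theorem eval_eq (h : HasVal a r v) : RatFunc.eval (RingHom.id ℚ) a r = v := by
  rw [RatFunc.eval, Polynomial.eval₂_id, Polynomial.eval₂_id, h.num_eval]
  exact mul_div_cancel_right₀ _ h.denom_eval_ne_zero

theorem unique (h : HasVal a r v) (h' : HasVal a r w) : v = w := by
  rw [← h.eval_eq, h'.eval_eq]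

/-- Evaluating `r(q^n)` at `a` is evaluating `r` at `a^n`. For `a = |k|` this is the order of the
degree `n` extension, which is how Adams operators meet field extensions. -/
theorem substPow {n : ℕ} (h : HasVal (a ^ n) r v) : HasVal a (substPow n r) v := by
  have hsub : ∀ p : ℚ[X], p.eval₂ (algebraMap ℚ (RatFunc ℚ)) (RatFunc.X ^ n) =
      algebraMap ℚ[X] (RatFunc ℚ) (p.comp (Polynomial.X ^ n)) := fun p => by
    rw [Polynomial.comp, Polynomial.hom_eval₂]
    rw [Subsingleton.elim (algebraMap ℚ (RatFunc ℚ)) ((algebraMap ℚ[X] (RatFunc ℚ)).comp C)]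
    simp
  have hval : ∀ p : ℚ[X], HasVal a (p.eval₂ (algebraMap ℚ (RatFunc ℚ)) (RatFunc.X ^ n))
      (p.eval (a ^ n)) := fun p => by
    rw [hsub]
    simpa using HasVal.ofPolynomial (a := a) (p.comp (Polynomial.X ^ n))
  have := (hval r.num).div (hval r.denom) h.denom_eval_ne_zero
  rwa [h.num_eval, mul_div_cancel_right₀ _ h.denom_eval_ne_zero] at this

/-- The numerator of the difference has infinitely many roots. -/
theorem eq_of_infinite {s : Set ℚ} (hs : s.Infinite) (f : ℚ → ℚ)
    (h : ∀ a ∈ s, HasVal a r (f a)) (h' : ∀ a ∈ s, HasVal a r' (f a)) : r = r' := by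
  rw [← sub_eq_zero, ← RatFunc.num_eq_zero_iff]
  refine Polynomial.eq_zero_of_infinite_isRoot _ (hs.mono fun a ha => ?_)
  have := ((h a ha).sub (h' a ha)).num_eval
  rwa [sub_self, zero_mul] at this

end HasVal

theorem exists_int_mul_eval (Q : ℚ[X]) :
    ∃ b : ℤ, b ≠ 0 ∧ ∀ q : ℤ, ∃ z : ℤ, (b : ℚ) * Q.eval (q : ℚ) = z := by
  induction Q using Polynomial.induction_on' with
  | add f g hf hg =>
    obtain ⟨b, hb, h⟩ := hf
    obtain ⟨c, hc, h'⟩ := hg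
    refine ⟨b * c, mul_ne_zero hb hc, fun q => ?_⟩
    obtain ⟨z, hz⟩ := h q
    obtain ⟨z', hz'⟩ := h' q
    refine ⟨c * z + b * z', ?_⟩
    push_cast
    rw [← hz, ← hz', eval_add]
    ring
  | monomial n c =>
    refine ⟨c.den, by exact_mod_cast c.den_nz, fun q => ⟨c.num * q ^ n, ?_⟩⟩
    rw [eval_monomial, ← mul_assoc]
    push_cast
    rw [mul_comm (c.den : ℚ), Rat.mul_den_eq_num]

/-- A rational function with integral values at infinitely many natural numbers is a
polynomial. -/
theorem exists_eq_algebraMap_of_int {r : RatFunc ℚ} {s : Set ℕ} (hs : s.Infinite)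
    (h : ∀ q ∈ s, ∃ z : ℤ, HasVal (q : ℚ) r z) : ∃ P : ℚ[X], r = algebraMap ℚ[X] (RatFunc ℚ) P := by
  set Q := r.num / r.denom with hQ
  set R := r.num % r.denom with hR
  have hdiv : r.denom * Q + R = r.num := EuclideanDomain.div_add_mod _ _
  have hdeg : R.degree < r.denom.degree := Polynomial.degree_mod_lt _ r.denom_ne_zero
  -- `b` clears the denominators of the polynomial part `Q`. Then `b` times the fractional part is
  -- an integer on `s` and tends to zero, hence is zero for large `q`, and the remainder `R` has
  -- infinitely many roots.
  obtain ⟨b, hb, hint⟩ := exists_int_mul_eval Q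
  have hlim : Filter.Tendsto (fun q : ℕ => R.eval (q : ℚ) / r.denom.eval (q : ℚ)) Filter.atTop
      (nhds 0) :=
    (Polynomial.div_tendsto_atTop_zero_of_degree_lt R r.denom hdeg).comp tendsto_natCast_atTop_atTop
  have hb' : (0 : ℚ) < |(b : ℚ)|⁻¹ := by
    have : (b : ℚ) ≠ 0 := by exact_mod_cast hb
    positivity
  obtain ⟨N, hN⟩ := (Metric.tendsto_atTop.1 hlim) |(b : ℚ)|⁻¹ (by exact_mod_cast hb')
  have hroot : ∀ q ∈ s, N ≤ q → R.eval (q : ℚ) = 0 := by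
    intro q hq hNq
    obtain ⟨z, hz⟩ := h q hq
    obtain ⟨y, hy⟩ := hint q
    rw [Int.cast_natCast] at hy
    have hd := hz.denom_eval_ne_zero
    have h1 : (b : ℚ) * (R.eval (q : ℚ) / r.denom.eval (q : ℚ)) = ((b * z - y : ℤ) : ℚ) := by
      have h2 := hz.num_eval
      rw [← hdiv, eval_add, eval_mul] at h2
      push_cast
      rw [← hy, eq_sub_of_add_eq' h2]
      field_simp
    have h3 : |R.eval (q : ℚ) / r.denom.eval (q : ℚ)| < |(b : ℚ)|⁻¹ := by
      have := hN q hNq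
      rw [Rat.dist_eq] at this
      simp only [Rat.cast_zero, sub_zero] at this
      exact_mod_cast this
    have h4 : |((b * z - y : ℤ) : ℚ)| < 1 := by
      rw [← h1, abs_mul]
      have : (0 : ℚ) < |(b : ℚ)| := by simpa using hb
      calc _ < |(b : ℚ)| * |(b : ℚ)|⁻¹ := by gcongr
        _ = 1 := mul_inv_cancel₀ this.ne'
    have h5 : b * z - y = 0 := by
      rw [← Int.abs_lt_one_iff]
      exact_mod_cast h4
    rw [h5, Int.cast_zero] at h1
    have h6 := (mul_eq_zero.1 h1).resolve_left (by exact_mod_cast hb)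
    exact (div_eq_zero_iff.1 h6).resolve_right hd
  have hR0 : R = 0 := by
    refine Polynomial.eq_zero_of_infinite_isRoot _ ?_
    have hinf : ((fun q : ℕ => (q : ℚ)) '' (s \ Set.Iio N)).Infinite :=
      (hs.sdiff (Set.finite_Iio N)).image Nat.cast_injective.injOn
    refine hinf.mono ?_
    rintro _ ⟨q, ⟨hq, hqN⟩, rfl⟩
    exact hroot q hq (by simpa using hqN)
  refine ⟨Q, ?_⟩
  rw [← RatFunc.num_div_denom r, ← hdiv, hR0, add_zero, map_mul,
    mul_div_cancel_left₀ _ (RatFunc.algebraMap_ne_zero r.denom_ne_zero)]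

/-- Quotients of power series with prescribed values of the coefficients. -/
theorem HasVal.coeff_of_mul_eq {a : ℚ} {f u g : (RatFunc ℚ)⟦X⟧} {φ υ γ : ℚ⟦X⟧} {D : ℕ}
    (hf : ∀ n ≤ D, HasVal a (PowerSeries.coeff n f) (PowerSeries.coeff n φ))
    (hg : ∀ n ≤ D, HasVal a (PowerSeries.coeff n g) (PowerSeries.coeff n γ))
    (hf0 : PowerSeries.coeff 0 f = 1) (hφ0 : PowerSeries.coeff 0 φ = 1)
    (h : u * f = g) (h' : υ * φ = γ) :
    ∀ n ≤ D, HasVal a (PowerSeries.coeff n u) (PowerSeries.coeff n υ) := by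
  intro n
  induction n using Nat.strong_induction_on with
  | _ n ih =>
    intro hn
    -- Since `f` has constant term `1`, its quotient is computed recursively without division, so
    -- values pass from numerator and denominator to the quotient.
    have key : ∀ {K : Type} [Field K] (f u : K⟦X⟧), PowerSeries.coeff 0 f = 1 →
        PowerSeries.coeff n u = PowerSeries.coeff n (u * f) -
          ∑ i ∈ Finset.range n, PowerSeries.coeff i u * PowerSeries.coeff (n - i) f := by
      intro K _ f u hf
      rw [PowerSeries.coeff_mul, Finset.Nat.sum_antidiagonal_eq_sum_range_succ_mk,
        Finset.sum_range_succ, Nat.sub_self, hf]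
      ring
    rw [key f u hf0, key φ υ hφ0, h, h']
    refine (hg n hn).sub (HasVal.sum _ _ _ fun i hi => ?_)
    have hi' := Finset.mem_range.1 hi
    exact (ih i hi' (by omega)).mul (hf _ (by omega))

end Values

/-! ### Finite index subgroups and Hall's recursion -/

section Subgroups

variable {m n : ℕ}

/-- The stabilizer of a point under the action of a free group given by permutations. -/
def pointStabilizer (p : (Fin m → Equiv.Perm (Fin n)) × Fin n) : Subgroup (FreeGroup (Fin m)) :=
  (MulAction.stabilizer (Equiv.Perm (Fin n)) p.2).comap (FreeGroup.lift p.1)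

theorem mem_pointStabilizer (p : (Fin m → Equiv.Perm (Fin n)) × Fin n) (g : FreeGroup (Fin m)) :
    g ∈ pointStabilizer p ↔ FreeGroup.lift p.1 g p.2 = p.2 := Iff.rfl

/-- The orbit map of a point with stabilizer `H`. -/
def orbitEmbedding (p : (Fin m → Equiv.Perm (Fin n)) × Fin n) {H : Subgroup (FreeGroup (Fin m))}
    (hH : pointStabilizer p = H) : FreeGroup (Fin m) ⧸ H ↪ Fin n :=
  have key : ∀ g g' : FreeGroup (Fin m), QuotientGroup.leftRel H g g' ↔
      FreeGroup.lift p.1 g p.2 = FreeGroup.lift p.1 g' p.2 := fun g g' => by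
    rw [QuotientGroup.leftRel_apply, ← hH, mem_pointStabilizer, map_mul, map_inv,
      Equiv.Perm.mul_apply, Equiv.Perm.inv_eq_iff_eq, eq_comm]
  { toFun := fun x => Quotient.liftOn' x (fun g => FreeGroup.lift p.1 g p.2)
      fun g g' h => (key g g').1 h
    inj' := fun x y => Quotient.inductionOn₂' x y fun g g' h => Quotient.sound' ((key g g').2 h) }

theorem exists_perm_smul_eq {N X : Type*} [Finite X] (f g : N ↪ X) :
    ∃ e : Equiv.Perm X, e • f = g := by
  classical
  have := Fintype.ofFinite X
  let e₀ : {x // x ∈ Set.range f} ≃ {x // x ∈ Set.range g} :=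
    (Equiv.ofInjective f f.injective).symm.trans (Equiv.ofInjective g g.injective)
  refine ⟨e₀.extendSubtype, Function.Embedding.ext fun x => ?_⟩
  rw [Function.Embedding.smul_apply, Equiv.Perm.smul_def,
    Equiv.extendSubtype_apply_of_mem e₀ _ ⟨x, rfl⟩]
  change ((Equiv.ofInjective g g.injective)
    ((Equiv.ofInjective f f.injective).symm ⟨f x, _⟩) : X) = g x
  rw [Equiv.ofInjective_symm_apply]
  rfl

theorem lift_apply_of_equivariant {H : Subgroup (FreeGroup (Fin m))}
    (γ : Fin m → Equiv.Perm (Fin n)) (f : FreeGroup (Fin m) ⧸ H ↪ Fin n)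
    (h : ∀ i, γ i • f =
      (MulAction.toPerm (FreeGroup.of i : FreeGroup (Fin m))).toEmbedding.trans f)
    (g : FreeGroup (Fin m)) (x : FreeGroup (Fin m) ⧸ H) :
    FreeGroup.lift γ g (f x) = f (g • x) := by
  have hof : ∀ i x, γ i (f x) = f (FreeGroup.of i • x) := fun i x => DFunLike.congr_fun (h i) x
  induction g using FreeGroup.induction_on generalizing x with
  | C1 => simp
  | of i => simpa using hof i x
  | inv_of i _ => rw [map_inv, FreeGroup.lift_apply_of, Equiv.Perm.inv_eq_iff_eq, hof,
      smul_inv_smul]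
  | mul a b ha hb => rw [map_mul, Equiv.Perm.mul_apply, hb, ha, mul_smul]

/-- The points with stabilizer `H` correspond to equivariant embeddings of the coset space. -/
def stabilizerFiberEquiv (H : Subgroup (FreeGroup (Fin m))) :
    {p : (Fin m → Equiv.Perm (Fin n)) × Fin n // pointStabilizer p = H} ≃
      {p : (Fin m → Equiv.Perm (Fin n)) × (FreeGroup (Fin m) ⧸ H ↪ Fin n) //
        ∀ i, p.1 i • p.2 =
          (MulAction.toPerm (FreeGroup.of i : FreeGroup (Fin m))).toEmbedding.trans p.2} where
  toFun p := ⟨(p.1.1, orbitEmbedding p.1 p.2), fun i => Function.Embedding.ext fun x =>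
    Quotient.inductionOn' x fun g => by
      change p.1.1 i (FreeGroup.lift p.1.1 g p.1.2) =
        FreeGroup.lift p.1.1 (FreeGroup.of i * g) p.1.2
      simp⟩
  invFun p := ⟨(p.1.1, p.1.2 (1 : FreeGroup (Fin m))), by
    obtain ⟨⟨γ, f⟩, h⟩ := p
    ext g
    rw [mem_pointStabilizer]
    dsimp only
    rw [lift_apply_of_equivariant γ f h, f.injective.eq_iff, eq_comm]
    change ((1 : FreeGroup (Fin m)) : FreeGroup (Fin m) ⧸ H) = ((g * 1 : FreeGroup (Fin m)) : _) ↔ _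
    rw [QuotientGroup.eq]
    simp⟩
  left_inv p := Subtype.ext (Prod.ext rfl (by
    change FreeGroup.lift p.1.1 1 p.1.2 = p.1.2
    simp))
  right_inv p := Subtype.ext (Prod.ext rfl (Function.Embedding.ext fun x =>
    Quotient.inductionOn' x fun g => by
      obtain ⟨⟨γ, f⟩, h⟩ := p
      change FreeGroup.lift γ g (f (1 : FreeGroup (Fin m))) = f (g : FreeGroup (Fin m) ⧸ H)
      rw [lift_apply_of_equivariant γ f h]
      change f ((g * 1 : FreeGroup (Fin m)) : FreeGroup (Fin m) ⧸ H) = _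
      rw [mul_one]))

theorem index_pointStabilizer (p : (Fin m → Equiv.Perm (Fin n)) × Fin n) :
    (pointStabilizer p).index ≠ 0 ∧ (pointStabilizer p).index ≤ n := by
  have f := orbitEmbedding p rfl
  have : Finite (FreeGroup (Fin m) ⧸ pointStabilizer p) := Finite.of_injective f f.injective
  refine ⟨Nat.card_pos.ne', (Nat.card_le_card_of_injective f f.injective).trans_eq (by simp)⟩

/-- An action on `n` points with a point of stabilizer `H` is a tuple of permutations compatible
with an embedding of the coset space. The symmetric group is transitive on these embeddings with
stabilizers of order `(n - [F_m : H])!`, so `card_tuple_smul_eq` applies as it did for `GL_n`. -/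
theorem card_stabilizerFiber (H : Subgroup (FreeGroup (Fin m))) (h0 : H.index ≠ 0)
    (hn : H.index ≤ n) :
    Nat.card {p : (Fin m → Equiv.Perm (Fin n)) × Fin n // pointStabilizer p = H} =
      n.descFactorial H.index * ((n - H.index).factorial) ^ m := by
  have : Finite (FreeGroup (Fin m) ⧸ H) := Nat.finite_of_card_ne_zero h0
  have := Fintype.ofFinite (FreeGroup (Fin m) ⧸ H)
  have hY : Nat.card (FreeGroup (Fin m) ⧸ H ↪ Fin n) = n.descFactorial H.index := by
    rw [Nat.card_eq_fintype_card, Fintype.card_embedding_eq, Fintype.card_fin,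
      ← Nat.card_eq_fintype_card]
    rfl
  rw [Nat.card_congr (stabilizerFiberEquiv H), ← hY]
  refine card_tuple_smul_eq exists_perm_smul_eq ?_ m _
  rw [hY, Nat.card_perm, Nat.card_eq_fintype_card, Fintype.card_fin, mul_comm,
    Nat.factorial_mul_descFactorial hn]

/-- The fiber count is positive, so each such `H` is a point stabilizer of one of finitely many
actions. -/
theorem finite_index_le (m n : ℕ) :
    {H : Subgroup (FreeGroup (Fin m)) | H.index ≠ 0 ∧ H.index ≤ n}.Finite := by
  refine (Set.finite_range (pointStabilizer (m := m) (n := n))).subset ?_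
  rintro H ⟨h0, hn⟩
  have h : Nat.card {p : (Fin m → Equiv.Perm (Fin n)) × Fin n // pointStabilizer p = H} ≠ 0 := by
    rw [card_stabilizerFiber H h0 hn]
    exact mul_ne_zero (Nat.descFactorial_eq_zero_iff_lt.not.2 (by omega))
      (pow_ne_zero _ (Nat.factorial_ne_zero _))
  obtain ⟨⟨p, hp⟩⟩ := (Nat.card_ne_zero.1 h).1
  exact ⟨p, hp⟩

/-- Hall's recursion for the number of subgroups of given index of a free group. -/
theorem sum_ncard_indexSubgroups (m n : ℕ) :
    ∑ j ∈ Finset.range (n + 1), (if j = 0 then 0 else ((indexSubgroups m j).ncard : ℚ)) *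
      ((n - j).factorial : ℚ) ^ ((m : ℤ) - 1) = n * (n.factorial : ℚ) ^ ((m : ℤ) - 1) := by
  classical
  have hfin := finite_index_le m n
  -- Sort all pairs of an action on `n` points and a marked point by the stabilizer of the point.
  have hcount : n.factorial ^ m * n = ∑ H ∈ hfin.toFinset,
      n.descFactorial H.index * ((n - H.index).factorial) ^ m := by
    have h1 : Nat.card ((Fin m → Equiv.Perm (Fin n)) × Fin n) = n.factorial ^ m * n := by
      simp [Fintype.card_perm]
    rw [← h1, Nat.card_eq_fintype_card, ← Finset.card_univ,
      Finset.card_eq_sum_card_fiberwise (f := pointStabilizer) (t := hfin.toFinset)]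
    · refine Finset.sum_congr rfl fun H hH => ?_
      rw [Set.Finite.mem_toFinset] at hH
      rw [← card_stabilizerFiber H hH.1 hH.2, Nat.card_eq_fintype_card, Fintype.card_subtype]
    · intro p _
      simpa using index_pointStabilizer p
  have hpart : ∀ F : ℕ → ℚ, ∑ H ∈ hfin.toFinset, F H.index = ∑ j ∈ Finset.range (n + 1),
      (if j = 0 then 0 else ((indexSubgroups m j).ncard : ℚ)) * F j := by
    intro F
    rw [← Finset.sum_fiberwise_of_maps_to (g := fun H : Subgroup (FreeGroup (Fin m)) => H.index)
      (t := Finset.range (n + 1))]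
    · refine Finset.sum_congr rfl fun j hj => ?_
      rw [Finset.sum_congr rfl (g := fun _ => F j) fun H hH => by rw [(Finset.mem_filter.1 hH).2],
        Finset.sum_const, nsmul_eq_mul]
      congr 1
      have hj' := Finset.mem_range.1 hj
      split_ifs with h0
      · rw [Nat.cast_eq_zero, Finset.card_eq_zero, Finset.filter_eq_empty_iff]
        intro H hH hHj
        rw [Set.Finite.mem_toFinset] at hH
        exact hH.1 (hHj.trans h0)
      · rw [← Set.ncard_coe_finset]
        congr 2
        ext H
        simp only [Finset.coe_filter, Set.Finite.mem_toFinset, Set.mem_ofPred_eq, indexSubgroups]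
        constructor
        · exact fun h => h.2
        · exact fun h => ⟨⟨by omega, by omega⟩, h⟩
    · intro H hH
      rw [Set.Finite.mem_toFinset] at hH
      exact Finset.mem_range.2 (Nat.lt_succ_of_le hH.2)
  have hne : ∀ j : ℕ, (j.factorial : ℚ) ≠ 0 := fun j => by exact_mod_cast j.factorial_ne_zero
  rw [← hpart (fun j => ((n - j).factorial : ℚ) ^ ((m : ℤ) - 1))]
  have hc : (n.factorial : ℚ) ^ m * n = ∑ H ∈ hfin.toFinset,
      (n.descFactorial H.index : ℚ) * ((n - H.index).factorial : ℚ) ^ m := by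
    exact_mod_cast hcount
  -- With `j` the index, `n!/(n-j)! · (n-j)!^m = n! (n-j)!^{m-1}`; the common factor `n!` is
  -- cancelled below.
  have hterm : ∀ H ∈ hfin.toFinset,
      (n.descFactorial H.index : ℚ) * ((n - H.index).factorial : ℚ) ^ m =
      n.factorial * ((n - H.index).factorial : ℚ) ^ ((m : ℤ) - 1) := by
    intro H hH
    rw [Set.Finite.mem_toFinset] at hH
    rw [← Nat.factorial_mul_descFactorial hH.2, zpow_sub₀ (hne _), zpow_natCast, zpow_one]
    have := hne (n - H.index)
    push_cast
    field_simp
  rw [Finset.sum_congr rfl hterm, ← Finset.mul_sum] at hc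
  apply mul_left_cancel₀ (hne n)
  rw [← hc, zpow_sub₀ (hne _), zpow_natCast, zpow_one]
  have := hne n
  field_simp

end Subgroups

/-! ### Absolute irreducibility, scalar endomorphisms and spanning -/

section AbsolutelyIrreducible

variable {k : Type} {G V : Type*} [Field k] [Group G] [AddCommGroup V] [Module k V]
  {ρ : Representation k G V}

theorem scalarExt_apply_tmul (K : Type*) [Field K] [Algebra k K] (ρ : Representation k G V) (g : G)
    (c : K) (v : V) : scalarExt K ρ g (c ⊗ₜ v) = c ⊗ₜ ρ g v := rfl

theorem isIrreducible_of_equiv {W : Type*} [AddCommGroup W] [Module k W]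
    {σ : Representation k G W} (e : Representation.Equiv ρ σ) (h : ρ.IsIrreducible) :
    σ.IsIrreducible := by
  obtain ⟨f⟩ := (nonempty_equiv_iff _ _).1 ⟨e⟩
  have := ρ.irreducible_iff_isSimpleModule_asModule.1 h
  exact σ.irreducible_iff_isSimpleModule_asModule.2 (IsSimpleModule.congr f.symm)

theorem IsAbsIrreducible.isIrreducible (h : IsAbsIrreducible ρ) : ρ.IsIrreducible := by
  refine isIrreducible_of_equiv (Representation.Equiv.mk (TensorProduct.lid k V) fun g => ?_) (h k)
  refine TensorProduct.ext' fun c v => ?_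
  simp [scalarExt_apply_tmul]

/-- The endomorphisms of an absolutely irreducible representation are scalars. -/
theorem IsAbsIrreducible.exists_eq_smul [FiniteDimensional k V] (h : IsAbsIrreducible ρ)
    (α : Module.End k V) (hα : ∀ g v, α (ρ g v) = ρ g (α v)) : ∃ c : k, ∀ v, α v = c • v := by
  have hirr := h.isIrreducible
  have := IsSimpleModule.nontrivial (MonoidAlgebra k G) ρ.asModule
  have hV : Nontrivial V := this
  -- Over this finite extension `α` has an eigenvalue `μ`. The eigenspace is a nonzero
  -- subrepresentation, hence everything, and `α` becomes the scalar `μ`.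
  let L := α.charpoly.SplittingField
  have hirrL := h L
  obtain ⟨μ, hμ⟩ := (Polynomial.SplittingField.splits α.charpoly).exists_eval_eq_zero (by
    rw [Polynomial.degree_map, Polynomial.degree_eq_natDegree α.charpoly_monic.ne_zero,
      LinearMap.charpoly_natDegree]
    exact_mod_cast (Module.finrank_pos (R := k) (M := V)).ne')
  have hμ' : (α.baseChange L).charpoly.IsRoot μ := by
    rw [LinearMap.charpoly_baseChange]
    exact hμ
  have heig := Module.End.hasEigenvalue_iff_isRoot_charpoly (α.baseChange L) μ |>.2 hμ'
  let P : Subrepresentation (scalarExt L ρ) :=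
    { toSubmodule := Module.End.eigenspace (α.baseChange L) μ
      apply_mem_toSubmodule := fun g v hv => by
        rw [Module.End.mem_eigenspace_iff] at hv ⊢
        have hcomm : α.baseChange L ∘ₗ scalarExt L ρ g = scalarExt L ρ g ∘ₗ α.baseChange L := by
          change α.baseChange L ∘ₗ (ρ g).baseChange L = (ρ g).baseChange L ∘ₗ α.baseChange L
          rw [← LinearMap.baseChange_comp, ← LinearMap.baseChange_comp]
          congr 1
          exact LinearMap.ext fun v => hα g v
        have := LinearMap.congr_fun hcomm v
        rw [LinearMap.comp_apply, LinearMap.comp_apply, hv, map_smul] at this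
        exact this }
  have hP : P = ⊤ := (eq_bot_or_eq_top P).resolve_left fun hb => by
    have hb' : P.toSubmodule = ⊥ := by rw [hb]; rfl
    exact heig hb'
  have hall : ∀ x, α.baseChange L x = μ • x := fun x => by
    have hx : x ∈ P.toSubmodule := by rw [hP]; trivial
    exact Module.End.mem_eigenspace_iff.1 hx
  let b := Module.finBasis k V
  have hcoord : ∀ i j, algebraMap k L (b.repr (α (b i)) j) = μ * algebraMap k L (b.repr (b i) j) := by
    intro i j
    have := congrArg (fun x => (b.baseChange L).repr x j) (hall (1 ⊗ₜ b i))
    simpa [Algebra.smul_def] using this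
  have hpos : 0 < Module.finrank k V := Module.finrank_pos
  -- The diagonal matrix entries of `α` already lie in `k`, so `μ` descends to `k`.
  have hdiag : ∀ i, algebraMap k L (b.repr (α (b i)) i) = μ := fun i => by simp [hcoord i i]
  refine ⟨b.repr (α (b ⟨0, hpos⟩)) ⟨0, hpos⟩, fun v => ?_⟩
  set c := b.repr (α (b ⟨0, hpos⟩)) ⟨0, hpos⟩ with hc
  have : α = c • LinearMap.id := b.ext fun i => b.repr.injective (Finsupp.ext fun j => by
    apply (algebraMap k L).injective
    rw [hcoord, ← hdiag ⟨0, hpos⟩, ← hc, ← map_mul]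
    simp [Finsupp.single_apply])
  rw [this]
  rfl

/-- A representation whose operators span all endomorphisms is absolutely irreducible. -/
theorem isAbsIrreducible_of_span_eq_top [FiniteDimensional k V] [Nontrivial V]
    (h : Submodule.span k (Set.range ρ) = ⊤) : IsAbsIrreducible ρ := by
  intro K _ _ _
  let b := Module.finBasis k V
  have hinv : ∀ (P : Subrepresentation (scalarExt K ρ)) (T : Module.End k V) (x : K ⊗[k] V),
      x ∈ P.toSubmodule → T.baseChange K x ∈ P.toSubmodule := by
    intro P T x hx
    have hT : T ∈ Submodule.span k (Set.range ρ) := h ▸ Submodule.mem_top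
    induction hT using Submodule.span_induction with
    | mem T hT =>
      obtain ⟨g, rfl⟩ := hT
      exact P.apply_mem_toSubmodule g hx
    | zero => simp
    | add S T _ _ hS hT =>
      rw [LinearMap.baseChange_add, LinearMap.add_apply]
      exact add_mem hS hT
    | smul c T _ hT =>
      rw [LinearMap.baseChange_smul, LinearMap.smul_apply, ← algebraMap_smul K c]
      exact P.toSubmodule.smul_mem _ hT
  have hnt : Nontrivial (K ⊗[k] V) := by
    have hpos : 0 < Module.finrank k V := Module.finrank_pos
    exact nontrivial_of_ne _ _ ((b.baseChange K).ne_zero ⟨0, hpos⟩)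
  refine @IsSimpleOrder.mk _ _ _ ⟨⊥, ⊤, fun hbt => ?_⟩ fun P => ?_
  · have : (⊥ : Submodule K (K ⊗[k] V)) = ⊤ := congrArg Subrepresentation.toSubmodule hbt
    exact bot_ne_top this
  · by_cases hP : P.toSubmodule = ⊥
    · exact Or.inl (Subrepresentation.toSubmodule_injective hP)
    · refine Or.inr (Subrepresentation.toSubmodule_injective ?_)
      obtain ⟨x, hx, hx0⟩ := P.toSubmodule.exists_mem_ne_zero_of_ne_bot hP
      obtain ⟨i, hi⟩ : ∃ i, (b.baseChange K).repr x i ≠ 0 := by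
        by_contra! hall
        exact hx0 ((b.baseChange K).repr.injective (Finsupp.ext fun i => by simp [hall i]))
      refine Eq.trans ?_ (rfl : (⊤ : Submodule K (K ⊗[k] V)) = _)
      rw [eq_top_iff, ← (b.baseChange K).span_eq, Submodule.span_le]
      rintro _ ⟨j, rfl⟩
      -- The endomorphism with `b i ↦ b j` that kills the other basis vectors sends `x` to a nonzero
      -- multiple of `b j`, so every `b j` lies in `P`.
      have hT := hinv P (b.constr k fun l => if l = i then b j else 0) x hx
      have hval : (b.constr k fun l => if l = i then b j else 0).baseChange K x =
          (b.baseChange K).repr x i • (b.baseChange K) j := by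
        conv_lhs => rw [← (b.baseChange K).sum_repr x]
        simp [map_sum, TensorProduct.tmul_zero, apply_ite]
      rw [hval] at hT
      have := P.toSubmodule.smul_mem ((b.baseChange K).repr x i)⁻¹ hT
      rwa [inv_smul_smul₀ hi] at this

end AbsolutelyIrreducible

/-! ### The endomorphism field and density -/

section Density

variable {k : Type} {G V : Type} [Field k] [Group G] [AddCommGroup V] [Module k V]

/-- The space of a representation as a module over the ring of its endomorphisms. -/
noncomputable abbrev endomorphismModule (ρ : Representation k G V) :
    Module (Module.End (MonoidAlgebra k G) ρ.asModule) V :=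
  Module.End.applyModule (R := MonoidAlgebra k G) (M := ρ.asModule)

/-- An irreducible representation on a finite space is a vector space over its endomorphism
field, and the group algebra maps onto the endomorphisms over this field. -/
theorem exists_endomorphism_field [Finite V] (ρ : Representation k G V) (h : ρ.IsIrreducible) :
    ∃ (E : Type) (_ : Field E) (_ : Algebra k E) (_ : Module E V) (_ : IsScalarTower k E V)
      (_ : Finite E),
      Nat.card E = Nat.card (Module.End (MonoidAlgebra k G) ρ.asModule) ∧
      (∀ g (a : E) v, ρ g (a • v) = a • ρ g v) ∧
      ∀ T : V →ₗ[E] V, ∃ b : MonoidAlgebra k G, ∀ v, ρ.asAlgebraHom b v = T v := by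
  classical
  have := ρ.irreducible_iff_isSimpleModule_asModule.1 h
  have hfin : Finite ρ.asModule := inferInstanceAs (Finite V)
  have : Finite (Module.End (MonoidAlgebra k G) ρ.asModule) := DFunLike.finite _
  -- By Schur's lemma the endomorphisms form a division ring; being finite, it is commutative.
  let F : Field (Module.End (MonoidAlgebra k G) ρ.asModule) := littleWedderburn _
  let M : Module (Module.End (MonoidAlgebra k G) ρ.asModule) V := endomorphismModule ρ
  let A : Algebra k (Module.End (MonoidAlgebra k G) ρ.asModule) :=
    Module.End.instAlgebra k (MonoidAlgebra k G) ρ.asModule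
  refine ⟨Module.End (MonoidAlgebra k G) ρ.asModule, F, A, M, ⟨fun c a v => rfl⟩, inferInstance,
    rfl, fun g a v => ?_, fun T => ?_⟩
  · exact (((Representation.IntertwiningMap.equivLinearMapAsModule ρ ρ).symm a).isIntertwining
      _ _ g v).symm
  · have := Fintype.ofFinite ρ.asModule
    let f : Module.End (Module.End (MonoidAlgebra k G) ρ.asModule) ρ.asModule :=
      { toFun := T, map_add' := T.map_add, map_smul' := T.map_smul }
    -- The module is finite, so density on finite subsets may be applied to all of it.
    obtain ⟨b, hb⟩ := jacobson_density f Finset.univ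
    exact ⟨b, fun v => (hb v (Finset.mem_univ _)).symm⟩

end Density

/-! ### Representations over a field and over a subfield -/

section Descent

variable {k K : Type} {G V W : Type} [Field k] [Field K] [Algebra k K] [Group G]
  [AddCommGroup V] [Module k V] [AddCommGroup W] [Module k W] [Module K W] [IsScalarTower k K W]

/-- The representation `σ` over `K` lies over the representation `ρ` over the subfield `k` if there
is a nonzero `k`-linear equivariant map from `ρ` to `σ`. -/
def LiesOver (ρ : Representation k G V) (σ : Representation K G W) : Prop :=
  ∃ f : V →ₗ[k] W, f ≠ 0 ∧ ∀ g v, f (ρ g v) = σ g (f v)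

theorem LiesOver.congr {W' : Type} [AddCommGroup W'] [Module k W'] [Module K W']
    [IsScalarTower k K W'] {ρ : Representation k G V} {σ : Representation K G W}
    {σ' : Representation K G W'} (h : LiesOver ρ σ) (e : Representation.Equiv σ σ') :
    LiesOver ρ σ' := by
  obtain ⟨f, hf, hfg⟩ := h
  refine ⟨(e.toLinearEquiv.toLinearMap.restrictScalars k) ∘ₗ f, fun h0 => hf ?_, fun g v => ?_⟩
  · ext v
    exact e.toLinearEquiv.injective ((LinearMap.congr_fun h0 v).trans
      (map_zero e.toLinearEquiv).symm)
  · change e (f (ρ g v)) = σ' g (e (f v))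
    rw [hfg]
    exact e.toIntertwiningMap.isIntertwining _ _ g (f v)

/-- The restriction of scalars of a representation to a subfield. -/
def restrictField (k : Type) [Field k] [Algebra k K] [Module k W] [IsScalarTower k K W]
    (σ : Representation K G W) : Representation k G W where
  toFun g := (σ g).restrictScalars k
  map_one' := by rw [map_one]; rfl
  map_mul' g h := by rw [map_mul]; rfl

/-- The action on `W` of the group algebra over the subfield. -/
noncomputable def subfieldAction (k : Type) [Field k] [Algebra k K] [Module k W]
    [IsScalarTower k K W] (σ : Representation K G W) : MonoidAlgebra k G →ₐ[k] Module.End K W :=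
  MonoidAlgebra.lift k _ G σ

theorem subfieldAction_apply {ρ : Representation k G V} {σ : Representation K G W}
    {f : V →ₗ[k] W} (hf : ∀ g v, f (ρ g v) = σ g (f v)) (b : MonoidAlgebra k G) (v : V) :
    f (ρ.asAlgebraHom b v) = subfieldAction k σ b (f v) := by
  induction b using MonoidAlgebra.induction_linear with
  | zero => simp
  | add x y hx hy => simp [hx, hy]
  | single g c => simp [subfieldAction, hf]

theorem subfieldAction_mem_span (σ : Representation K G W) (b : MonoidAlgebra k G) :
    subfieldAction k σ b ∈ Submodule.span K (Set.range σ) := by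
  induction b using MonoidAlgebra.induction_linear with
  | zero => simp
  | add x y hx hy => rw [map_add]; exact add_mem hx hy
  | single g c =>
    rw [subfieldAction, MonoidAlgebra.lift_single, ← algebraMap_smul K c]
    exact Submodule.smul_mem _ _ (Submodule.subset_span ⟨g, rfl⟩)

omit [Algebra k K] [IsScalarTower k K W] in
theorem span_range_eq_top {ρ : Representation k G V} {σ : Representation K G W}
    (hσ : σ.IsIrreducible) {f : V →ₗ[k] W} (hf0 : f ≠ 0) (hf : ∀ g v, f (ρ g v) = σ g (f v)) :
    Submodule.span K (Set.range f) = ⊤ := by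
  let P : Subrepresentation σ :=
    { toSubmodule := Submodule.span K (Set.range f)
      apply_mem_toSubmodule := fun g v hv => by
        induction hv using Submodule.span_induction with
        | mem w hw =>
          obtain ⟨v, rfl⟩ := hw
          rw [← hf]
          exact Submodule.subset_span ⟨_, rfl⟩
        | zero => simp
        | add x y _ _ hx hy => rw [map_add]; exact add_mem hx hy
        | smul c x _ hx => rw [map_smul]; exact Submodule.smul_mem _ _ hx }
  have hP : P = ⊤ := (eq_bot_or_eq_top P).resolve_left fun hb => hf0 (by
    ext v
    have hv : f v ∈ P.toSubmodule := Submodule.subset_span ⟨v, rfl⟩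
    rw [hb] at hv
    exact hv)
  exact congrArg Subrepresentation.toSubmodule hP

/-- A representation lies over at most one irreducible representation of a subfield. -/
theorem LiesOver.unique {V' : Type} [AddCommGroup V'] [Module k V'] {ρ : Representation k G V}
    {ρ' : Representation k G V'} {σ : Representation K G W} (hσ : σ.IsIrreducible)
    (hρ : ρ.IsIrreducible) (hρ' : ρ'.IsIrreducible) (h : LiesOver ρ σ) (h' : LiesOver ρ' σ) :
    Nonempty (ρ.asModule ≃ₗ[MonoidAlgebra k G] ρ'.asModule) := by
  obtain ⟨f, hf0, hf⟩ := h
  obtain ⟨f', hf0', hf'⟩ := h'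
  have := ρ.irreducible_iff_isSimpleModule_asModule.1 hρ
  have := ρ'.irreducible_iff_isSimpleModule_asModule.1 hρ'
  let σk := restrictField k σ
  let F : K → (ρ.asModule →ₗ[MonoidAlgebra k G] σk.asModule) := fun c =>
    Representation.IntertwiningMap.equivLinearMapAsModule ρ σk
      ⟨DistribSMul.toLinearMap k W c ∘ₗ f, fun g => LinearMap.ext fun v => by
          change c • f (ρ g v) = σ g (c • f v)
          rw [hf, map_smul]⟩
  let F' : ρ'.asModule →ₗ[MonoidAlgebra k G] σk.asModule :=
    Representation.IntertwiningMap.equivLinearMapAsModule ρ' σk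
      ⟨f', fun g => LinearMap.ext fun v => hf' g v⟩
  have hF : ∀ (c : K) (v : V), F c v = c • f v := fun c v => rfl
  have hF0 : ∀ c : K, c ≠ 0 → F c ≠ 0 := fun c hc h0 => hf0 (LinearMap.ext fun v => by
    have : c • f v = 0 := LinearMap.congr_fun h0 v
    exact (smul_eq_zero.1 this).resolve_left hc)
  have hF'0 : F' ≠ 0 := fun h0 => hf0' (LinearMap.ext fun v => LinearMap.congr_fun h0 v)
  have eF : ∀ c : K, c ≠ 0 → (ρ.asModule ≃ₗ[MonoidAlgebra k G] LinearMap.range (F c)) :=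
    fun c hc => LinearEquiv.ofInjective _ (LinearMap.injective_of_ne_zero (hF0 c hc))
  have eF' : ρ'.asModule ≃ₗ[MonoidAlgebra k G] LinearMap.range F' :=
    LinearEquiv.ofInjective _ (LinearMap.injective_of_ne_zero hF'0)
  -- The translates `c • f(V)` are simple over `k[G]`, isomorphic to `ρ`, and sum to `W` because
  -- `f(V)` spans `W` over `K`. Every simple submodule of `W`, in particular the image of `f'`, is
  -- therefore isomorphic to `ρ`.
  let s : Set (Submodule (MonoidAlgebra k G) σk.asModule) :=
    {N | ∃ c : K, c ≠ 0 ∧ N = LinearMap.range (F c)}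
  have hsimple : ∀ N : s, IsSimpleModule (MonoidAlgebra k G) N.1 := by
    rintro ⟨_, c, hc, rfl⟩
    exact IsSimpleModule.congr (eF c hc).symm
  have hs : sSup s = ⊤ := by
    rw [eq_top_iff]
    rintro w -
    have hw : (w : W) ∈ Submodule.span K (Set.range f) := by
      rw [span_range_eq_top hσ hf0 hf]; trivial
    induction hw using Submodule.closure_induction with
    | zero => exact zero_mem (sSup s)
    | add x y _ _ hx hy => exact add_mem hx hy
    | smul_mem c x hx =>
      obtain ⟨v, rfl⟩ := hx
      by_cases hc : c = 0
      · subst hc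
        have h0 : (0 : K) • f v = (0 : W) := zero_smul _ _
        exact h0.symm ▸ zero_mem (sSup s)
      · have hv : F c v ∈ sSup s := Submodule.mem_sSup_of_mem
          (show LinearMap.range (F c) ∈ s from ⟨c, hc, rfl⟩) (LinearMap.mem_range_self (F c) v)
        exact hv
  have hN : IsSimpleModule (MonoidAlgebra k G) (LinearMap.range F') := IsSimpleModule.congr eF'.symm
  obtain ⟨N, ⟨c, hc, rfl⟩, ⟨e⟩⟩ := Submodule.linearEquiv_of_sSup_eq_top (LinearMap.range F') s hs
  exact ⟨((eF'.trans e).trans (eF c hc).symm).symm⟩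

end Descent

/-! ### Representations from embeddings of the endomorphism field -/

section Twist

variable {k K : Type} {G V : Type} [Field k] [Field K] [Algebra k K] [Group G]
  [AddCommGroup V] [Module k V] {ρ : Representation k G V}
  {E : Type} [Field E] [Algebra k E] [Module E V] [IsScalarTower k E V]

/-- A representation commuting with the scalars of a larger field, as a representation over
this field. -/
def extendField (ρ : Representation k G V) (hE : ∀ g (a : E) v, ρ g (a • v) = a • ρ g v) :
    Representation E G V where
  toFun g := { toFun := ρ g, map_add' := (ρ g).map_add, map_smul' := hE g }
  map_one' := by ext v; simp
  map_mul' g h := by ext v; simp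

variable (hE : ∀ g (a : E) v, ρ g (a • v) = a • ρ g v) {e : ℕ} (b : Module.Basis (Fin e) E V)
  (φ : E →ₐ[k] K)

/-- The representation over `K` obtained by applying the embedding `φ : E → K` to the matrices of
a representation over `E`. -/
noncomputable def twistRep : Representation K G (Fin e → K) :=
  ((Matrix.toLinAlgEquiv' : Matrix (Fin e) (Fin e) K ≃ₐ[K] _) : _ →* _).comp
    ((RingHom.mapMatrix (m := Fin e) (φ : E →+* K)).toMonoidHom.comp
      (((LinearMap.toMatrixAlgEquiv b : _ ≃ₐ[E] _) : _ →* _).comp (extendField ρ hE)))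

/-- The coordinates of a vector, embedded into `K`. -/
noncomputable def twistCoord : V →ₗ[k] (Fin e → K) where
  toFun v i := φ (b.repr v i)
  map_add' v w := by ext i; simp
  map_smul' c v := by
    ext i
    change φ (b.repr (c • v) i) = c • φ (b.repr v i)
    rw [← algebraMap_smul E c v, map_smul, Finsupp.smul_apply, smul_eq_mul, map_mul, φ.commutes,
      Algebra.smul_def]

theorem twistCoord_smul (a : E) (v : V) : twistCoord b φ (a • v) = φ a • twistCoord b φ v := by
  ext i
  simp [twistCoord]

theorem twistCoord_basis (i : Fin e) : twistCoord b φ (b i) = Pi.single i 1 := by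
  ext j
  simp [twistCoord, Finsupp.single_apply, Pi.single_apply, eq_comm, apply_ite φ]

theorem twistCoord_equivariant (g : G) (v : V) :
    twistCoord b φ (ρ g v) = twistRep hE b φ g (twistCoord b φ v) := by
  have h : b.repr (extendField ρ hE g v) =
      (LinearMap.toMatrixAlgEquiv b (extendField ρ hE g)).mulVec (b.repr v) :=
    (LinearMap.toMatrix_mulVec_repr b b (extendField ρ hE g) v).symm
  ext i
  change φ (b.repr (extendField ρ hE g v) i) = (((LinearMap.toMatrixAlgEquiv b
    (extendField ρ hE g)).map φ).mulVec fun j => φ (b.repr v j)) i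
  rw [h]
  exact RingHom.map_mulVec (φ : E →+* K) _ _ i

variable (hd : ∀ T : V →ₗ[E] V, ∃ c : MonoidAlgebra k G, ∀ v, ρ.asAlgebraHom c v = T v)

-- Density carried to the twist: an element of `k[G]` acting on `V` as `T` acts on `K^e` by the
-- matrix of `T` with `φ` applied to its entries.
include hd in
theorem exists_subfieldAction_twistRep (T : V →ₗ[E] V) :
    ∃ c : MonoidAlgebra k G, (∀ v, ρ.asAlgebraHom c v = T v) ∧
      ∀ i, subfieldAction k (twistRep hE b φ) c (Pi.single i 1) = twistCoord b φ (T (b i)) := by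
  obtain ⟨c, hc⟩ := hd T
  refine ⟨c, hc, fun i => ?_⟩
  rw [← twistCoord_basis b φ, ← subfieldAction_apply (twistCoord_equivariant hE b φ), hc]

-- Matrix units have entries `0` and `1`, so they are realized over `E` by density and survive the
-- embedding; over `K` they span all endomorphisms.
include hd in
theorem isAbsIrreducible_twistRep (he : e ≠ 0) : IsAbsIrreducible (twistRep hE b φ) := by
  have : NeZero e := ⟨he⟩
  refine isAbsIrreducible_of_span_eq_top ?_
  have hunit : ∀ i j, Matrix.toLin' (Matrix.single i j (1 : K)) ∈
      Submodule.span K (Set.range (twistRep hE b φ)) := by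
    intro i j
    obtain ⟨c, -, hc⟩ := exists_subfieldAction_twistRep hE b φ hd
      (b.constr E fun l => if l = j then b i else 0)
    have : Matrix.toLin' (Matrix.single i j (1 : K)) = subfieldAction k (twistRep hE b φ) c := by
      refine LinearMap.pi_ext' fun l => LinearMap.ext_ring ?_
      rw [LinearMap.comp_apply, LinearMap.comp_apply, LinearMap.single_apply, hc,
        Module.Basis.constr_basis]
      by_cases h : l = j
      · subst h
        rw [if_pos rfl, twistCoord_basis]
        ext x
        simp [Matrix.single_apply, Pi.single_apply, eq_comm]
      · rw [if_neg h, map_zero]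
        ext x
        simp [Ne.symm h]
    rw [this]
    exact subfieldAction_mem_span _ _
  rw [eq_top_iff]
  rintro T -
  rw [← Matrix.toLin'_toMatrix' T, Matrix.matrix_eq_sum_single (LinearMap.toMatrix' T), map_sum]
  refine sum_mem fun i _ => ?_
  rw [map_sum]
  refine sum_mem fun j _ => ?_
  have : Matrix.single i j (LinearMap.toMatrix' T i j) =
      LinearMap.toMatrix' T i j • Matrix.single i j (1 : K) := by simp
  rw [this, map_smul]
  exact Submodule.smul_mem _ _ (hunit i j)

theorem liesOver_twistRep (he : e ≠ 0) : LiesOver ρ (twistRep hE b φ) := by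
  refine ⟨twistCoord b φ, fun h => ?_, twistCoord_equivariant hE b φ⟩
  have := LinearMap.congr_fun h (b ⟨0, Nat.pos_of_ne_zero he⟩)
  rw [twistCoord_basis] at this
  simp at this

-- An element of `k[G]` acting on `V` as the scalar `a ∈ E` acts on the twists as `φ a` and `φ' a`;
-- an isomorphism forces these scalars to agree.
include hd in
theorem eq_of_twistRep_equiv (he : e ≠ 0) {φ φ' : E →ₐ[k] K}
    (h : Representation.Equiv (twistRep hE b φ) (twistRep hE b φ')) : φ = φ' := by
  ext a
  obtain ⟨c, hc⟩ := hd (LinearMap.lsmul E V a)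
  have hact : ∀ (ψ : E →ₐ[k] K) (x : Fin e → K),
      subfieldAction k (twistRep hE b ψ) c x = ψ a • x := by
    intro ψ x
    have : subfieldAction k (twistRep hE b ψ) c = ψ a • LinearMap.id := by
      refine LinearMap.pi_ext' fun l => LinearMap.ext_ring ?_
      rw [LinearMap.comp_apply, LinearMap.single_apply, ← twistCoord_basis b ψ,
        ← subfieldAction_apply (twistCoord_equivariant hE b ψ), hc]
      change twistCoord b ψ (a • b l) = _
      rw [twistCoord_smul, twistCoord_basis]
      rfl
    rw [this]
    rfl
  have hcomm : ∀ (c : MonoidAlgebra k G) (x : Fin e → K),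
      h (subfieldAction k (twistRep hE b φ) c x) = subfieldAction k (twistRep hE b φ') c (h x) := by
    intro c x
    induction c using MonoidAlgebra.induction_linear with
    | zero => simp
    | add c d hc hd => simp [hc, hd]
    | single g r =>
      have := h.toIntertwiningMap.isIntertwining _ _ g x
      simp only [subfieldAction, MonoidAlgebra.lift_single, LinearMap.smul_apply]
      rw [← algebraMap_smul K r, ← algebraMap_smul K r, map_smul]
      exact congrArg _ this
  have h1 := hcomm c (Pi.single ⟨0, Nat.pos_of_ne_zero he⟩ 1)
  rw [hact, hact, map_smul, ← sub_eq_zero, ← sub_smul, smul_eq_zero] at h1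
  refine sub_eq_zero.1 (h1.resolve_right fun h0 => ?_)
  have h2 := h.toLinearEquiv.injective (h0.trans (map_zero h.toLinearEquiv).symm)
  simp at h2

section Structure

variable {W : Type} [AddCommGroup W] [Module k W] [Module K W] [IsScalarTower k K W]
  [FiniteDimensional K W] {σ : Representation K G W}

include hE hd in
/-- The endomorphism field of `ρ` acts through an embedding on an absolutely irreducible
representation lying over `ρ`. -/
theorem exists_embedding_of_equivariant (hσ : IsAbsIrreducible σ) {f : V →ₗ[k] W} (hf0 : f ≠ 0)
    (hf : ∀ g v, f (ρ g v) = σ g (f v)) :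
    ∃ φ : E →ₐ[k] K, ∀ a v, f (a • v) = φ a • f v := by
  have hspan := span_range_eq_top hσ.isIrreducible hf0 hf
  have key : ∀ a : E, ∃ c : K, ∀ v, f (a • v) = c • f v := by
    intro a
    obtain ⟨β, hβ⟩ := hd (LinearMap.lsmul E V a)
    have hβf : ∀ v, subfieldAction k σ β (f v) = f (a • v) := fun v => by
      rw [← subfieldAction_apply hf, hβ]
      rfl
    -- The action of `β` commutes with `G` on `f(V)`, hence on its `K`-span `W`, so it is a scalar
    -- by absolute irreducibility.
    obtain ⟨c, hc⟩ := hσ.exists_eq_smul (subfieldAction k σ β) fun g w => by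
      have hw : w ∈ Submodule.span K (Set.range f) := hspan ▸ Submodule.mem_top
      induction hw using Submodule.span_induction with
      | mem w hw =>
        obtain ⟨v, rfl⟩ := hw
        rw [← hf, hβf, hβf, ← hE, hf]
      | zero => simp
      | add x y _ _ hx hy => simp only [map_add, hx, hy]
      | smul r x _ hx => simp only [map_smul, hx]
    exact ⟨c, fun v => by rw [← hβf, hc]⟩
  choose φ hφ using key
  obtain ⟨v, hv⟩ : ∃ v, f v ≠ 0 := by
    by_contra! hall
    exact hf0 (LinearMap.ext hall)
  have huniq : ∀ c d : K, c • f v = d • f v → c = d := fun c d h =>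
    smul_left_injective K hv h
  refine ⟨{ toFun := φ, map_one' := ?_, map_mul' := ?_, map_zero' := ?_, map_add' := ?_,
            commutes' := ?_ }, hφ⟩
  · exact huniq _ _ (by rw [← hφ, one_smul, one_smul])
  · intro a b
    exact huniq _ _ (by rw [← hφ, mul_smul, hφ, hφ, mul_smul])
  · exact huniq _ _ (by rw [← hφ, zero_smul, zero_smul, map_zero])
  · intro a b
    exact huniq _ _ (by rw [← hφ, add_smul, map_add, hφ, hφ, add_smul])
  · intro c
    exact huniq _ _ (by rw [← hφ, algebraMap_smul, algebraMap_smul, map_smul])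

omit [IsScalarTower k E V] [FiniteDimensional K W] in
include hd in
/-- An absolutely irreducible representation lying over `ρ` is obtained from `ρ` by an embedding
of the endomorphism field. -/
theorem exists_basis_of_equivariant {ι : Type} [Fintype ι] [DecidableEq ι]
    (b : Module.Basis ι E V) (hσ : σ.IsIrreducible) {f : V →ₗ[k] W}
    (hf0 : f ≠ 0) (hf : ∀ g v, f (ρ g v) = σ g (f v)) (φ : E →ₐ[k] K)
    (hφ : ∀ a v, f (a • v) = φ a • f v) :
    ∃ c : Module.Basis ι K W, ∀ i, c i = f (b i) := by
  have hsum : ∀ v, f v = ∑ i, φ (b.repr v i) • f (b i) := fun v => by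
    conv_lhs => rw [← b.sum_repr v, map_sum]
    exact Finset.sum_congr rfl fun i _ => hφ _ _
  have hne : ∀ i, f (b i) ≠ 0 := by
    intro i hi
    refine hf0 (LinearMap.ext fun v => ?_)
    rw [hsum]
    refine Finset.sum_eq_zero fun j _ => ?_
    -- This `c` sends `b i` to `b j`, so if `f` killed one basis vector it would kill all.
    obtain ⟨c, hc⟩ := hd (b.constr E fun _ => b j)
    have := subfieldAction_apply hf c (b i)
    rw [hc, Module.Basis.constr_basis, hi, map_zero] at this
    rw [this, smul_zero]
  have hli : LinearIndependent K fun i => f (b i) := by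
    rw [Fintype.linearIndependent_iff]
    intro r hr i
    -- This `c` projects onto the line of `b i` and isolates one term of the linear relation.
    obtain ⟨c, hc⟩ := hd (b.constr E fun l => if l = i then b i else 0)
    have h := congrArg (subfieldAction k σ c) hr
    rw [map_zero, map_sum, Finset.sum_eq_single i] at h
    · rw [map_smul, ← subfieldAction_apply hf, hc, Module.Basis.constr_basis, if_pos rfl] at h
      exact (smul_eq_zero.1 h).resolve_right (hne i)
    · intro j _ hj
      rw [map_smul, ← subfieldAction_apply hf, hc, Module.Basis.constr_basis, if_neg hj, map_zero,
        smul_zero]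
    · simp
  refine ⟨Module.Basis.mk hli ?_, fun i => Module.Basis.mk_apply _ _ _⟩
  rw [← span_range_eq_top hσ hf0 hf, Submodule.span_le]
  rintro _ ⟨v, rfl⟩
  rw [hsum]
  exact sum_mem fun i _ => Submodule.smul_mem _ _ (Submodule.subset_span ⟨i, rfl⟩)

omit [FiniteDimensional K W] in
include hd in
theorem nonempty_twistRep_equiv (hσ : σ.IsIrreducible) {f : V →ₗ[k] W}
    (hf0 : f ≠ 0) (hf : ∀ g v, f (ρ g v) = σ g (f v)) (φ : E →ₐ[k] K)
    (hφ : ∀ a v, f (a • v) = φ a • f v) :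
    Nonempty (Representation.Equiv (twistRep hE b φ) σ) := by
  obtain ⟨c, hc⟩ := exists_basis_of_equivariant hd b hσ hf0 hf φ hφ
  have hcoord : ∀ v, c.equivFun (f v) = twistCoord b φ v := fun v => by
    rw [← c.equivFun.eq_symm_apply, Module.Basis.equivFun_symm_apply]
    conv_lhs => rw [← b.sum_repr v, map_sum]
    exact Finset.sum_congr rfl fun i _ => by rw [hφ, hc]; rfl
  refine ⟨Representation.Equiv.symm (Representation.Equiv.mk c.equivFun fun g => c.ext fun i => ?_)⟩
  change c.equivFun (σ g (c i)) = twistRep hE b φ g (c.equivFun (c i))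
  rw [hc, ← hf, hcoord, hcoord, twistCoord_equivariant]

end Structure

end Twist

/-! ### Counting by Galois descent -/

section DescentCount

variable {k K : Type} [Field k] [Finite k] [Field K] [Finite K] [Algebra k K] {m : ℕ}

omit [Finite k] in
theorem card_algHom_eq {E : Type} [Field E] [Algebra k E] :
    Nat.card (E →ₐ[k] K) =
      if Module.finrank k E ∣ Module.finrank k K then Module.finrank k E else 0 := by
  split_ifs with h
  · exact FiniteField.natCard_algHom_of_finrank_dvd h
  · rw [Nat.card_eq_zero]
    left
    rw [← not_nonempty_iff, FiniteField.nonempty_algHom_iff_finrank_dvd]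
    exact h

/-- The isomorphism classes of absolutely irreducible representations that lie over a given
representation over a subfield. -/
abbrev OverClass (e : ℕ) (K : Type) [Field K] [Algebra k K] {V : Type} [AddCommGroup V]
    [Module k V] (ρ : Representation k (FreeGroup (Fin m)) V) : Type :=
  {w : Quotient (absIrrSetoid m e K) // ∃ σ : AbsIrrRep m e K, ⟦σ⟧ = w ∧ LiesOver ρ σ.1}

/-- The classes over `ρ` correspond to the `k`-embeddings into `K` of its endomorphism field `E`, of
degree `s`: there are `s` of them if `s` divides `[K : k]` and none otherwise. The dimension of such
a class is `dim_E V`, whence the condition `dim_k V = e s`. -/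
theorem card_overClass {V : Type} [AddCommGroup V] [Module k V] [Finite V]
    (ρ : Representation k (FreeGroup (Fin m)) V) (hρ : ρ.IsIrreducible) {e s : ℕ} (he : e ≠ 0)
    (hs : Nat.card (Module.End (MonoidAlgebra k (FreeGroup (Fin m))) ρ.asModule) =
      Nat.card k ^ s) :
    Nat.card (OverClass e K ρ) =
      if Module.finrank k V = e * s ∧ s ∣ Module.finrank k K then s else 0 := by
  obtain ⟨E, _, _, _, _, _, hcard, hE, hd⟩ := exists_endomorphism_field ρ hρ
  obtain rfl : Module.finrank k E = s := by
    rw [← hcard, Module.natCard_eq_pow_finrank (K := k)] at hs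
    exact Nat.pow_right_injective Finite.one_lt_card hs
  have : Module.Finite k V := Module.Finite.of_finite
  have : Module.Finite k E := Module.Finite.of_finite
  have : Module.Finite E V := Module.Finite.of_finite
  have hdim : Module.finrank k V = Module.finrank E V * Module.finrank k E := by
    rw [mul_comm, Module.finrank_mul_finrank]
  have hpos : 0 < Module.finrank k E := Module.finrank_pos
  let b := Module.finBasis E V
  by_cases hee : Module.finrank E V = e
  · subst hee
    simp only [← hdim, true_and]
    rw [← card_algHom_eq]
    let F : (E →ₐ[k] K) → OverClass (Module.finrank E V) K ρ := fun φ =>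
      ⟨⟦⟨twistRep hE b φ, isAbsIrreducible_twistRep hE b φ hd he⟩⟧, _, rfl,
        liesOver_twistRep hE b φ he⟩
    refine (Nat.card_congr (Equiv.ofBijective F ⟨fun φ φ' h => ?_, ?_⟩)).symm
    · obtain ⟨h'⟩ := Quotient.exact (congrArg Subtype.val h)
      exact eq_of_twistRep_equiv hE b hd he h'
    · rintro ⟨_, ⟨σ, hσ⟩, rfl, f, hf0, hf⟩
      obtain ⟨φ, hφ⟩ := exists_embedding_of_equivariant hE hd hσ hf0 hf
      exact ⟨φ, Subtype.ext (Quotient.sound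
        (nonempty_twistRep_equiv hE b hd hσ.isIrreducible hf0 hf φ hφ))⟩
  · rw [if_neg fun h => hee (Nat.eq_of_mul_eq_mul_right hpos (hdim.symm.trans h.1)),
      Nat.card_eq_zero]
    left
    refine ⟨?_⟩
    rintro ⟨_, ⟨σ, hσ⟩, rfl, f, hf0, hf⟩
    obtain ⟨φ, hφ⟩ := exists_embedding_of_equivariant hE hd hσ hf0 hf
    obtain ⟨c, -⟩ := exists_basis_of_equivariant hd b hσ.isIrreducible hf0 hf φ hφ
    apply hee
    have := Module.finrank_eq_card_basis c
    simpa using this.symm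

/-- The degree of the endomorphism field of an irreducible representation. -/
noncomputable def irrEndDeg {D : ℕ} (i : IrrIndex m D k) : ℕ :=
  Module.finrank k (Module.End (MonoidAlgebra k (FreeGroup (Fin m))) (irrRep i).asModule)

theorem irrEndCard_eq {D : ℕ} (i : IrrIndex m D k) :
    irrEndCard i = Nat.card k ^ irrEndDeg i := by
  have : Finite (Module.End (MonoidAlgebra k (FreeGroup (Fin m))) (irrRep i).asModule) :=
    DFunLike.finite _
  exact Module.natCard_eq_pow_finrank (K := k)
    (V := Module.End (MonoidAlgebra k (FreeGroup (Fin m))) (irrRep i).asModule)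

theorem irrEndDeg_dvd_irrDim {D : ℕ} (i : IrrIndex m D k) : irrEndDeg i ∣ irrDim i := by
  obtain ⟨E, _, _, _, _, _, hcard, -, -⟩ := exists_endomorphism_field (irrRep i) inferInstance
  have hE : Module.finrank k E = irrEndDeg i := by
    have h : irrEndCard i = _ := irrEndCard_eq i
    rw [irrEndCard, ← hcard, Module.natCard_eq_pow_finrank (K := k)] at h
    exact Nat.pow_right_injective Finite.one_lt_card h
  have hdim : Module.finrank k (Fin i.1 → k) = irrDim i := by simp [irrDim]
  have : Module.Finite E (Fin i.1 → k) := Module.Finite.of_finite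
  exact ⟨Module.finrank E (Fin i.1 → k), by rw [← hE, Module.finrank_mul_finrank, hdim]⟩

theorem irrEndDeg_pos {D : ℕ} (i : IrrIndex m D k) : 0 < irrEndDeg i := by
  have h := one_lt_irrEndCard i
  rw [irrEndCard_eq] at h
  by_contra h0
  obtain h0 : irrEndDeg i = 0 := by omega
  rw [h0, pow_zero] at h
  exact lt_irrefl _ h

-- Take a simple submodule of `σ` viewed over `k`, a space of dimension `e [K : k]`.
omit [Finite k] in
theorem exists_liesOver_irrRep {e D : ℕ} (he : e ≠ 0) (hD : e * Module.finrank k K ≤ D)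
    (σ : Representation K (FreeGroup (Fin m)) (Fin e → K)) :
    ∃ i : IrrIndex m D k, LiesOver (irrRep i) σ := by
  have : NeZero e := ⟨he⟩
  have : Module.Finite k K := Module.Finite.of_finite
  let σk := restrictField k σ
  have hfinW : Finite σk.asModule := inferInstanceAs (Finite (Fin e → K))
  have hnt : Nontrivial σk.asModule := inferInstanceAs (Nontrivial (Fin e → K))
  have hfr : Module.finrank k σk.asModule = e * Module.finrank k K :=
    (LinearEquiv.finrank_eq σk.asModuleEquiv).trans (by
      rw [Module.finrank_pi_fintype]; simp)
  have : Finite (Submodule (MonoidAlgebra k (FreeGroup (Fin m))) σk.asModule) :=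
    Finite.of_injective (fun N => (N : Set σk.asModule)) SetLike.coe_injective
  obtain ⟨T, hT⟩ := IsAtomic.exists_atom
    (Submodule (MonoidAlgebra k (FreeGroup (Fin m))) σk.asModule)
  have := isSimpleModule_iff_isAtom.2 hT
  obtain ⟨i, ⟨ε⟩⟩ := exists_irrRep_equiv (k := k) (m := m) (D := D) T
    ((Submodule.finrank_le (T.restrictScalars k)).trans (by omega))
  let f := (Representation.IntertwiningMap.equivLinearMapAsModule (irrRep i) σk).symm
    (T.subtype ∘ₗ ε.symm.toLinearMap)
  refine ⟨i, f.toLinearMap, fun h0 => ?_, fun g v => f.isIntertwining _ _ g v⟩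
  have hT' := IsSimpleModule.nontrivial (MonoidAlgebra k (FreeGroup (Fin m))) T
  obtain ⟨t, ht⟩ := exists_ne (0 : T)
  have h1 : (T.subtype ∘ₗ ε.symm.toLinearMap) (ε t) = 0 := LinearMap.congr_fun h0 (ε t)
  exact ht (by simpa using h1)

/-- Galois descent: the absolutely irreducible representations over an extension of a finite
field, counted by the irreducible representations over the base field. -/
theorem absIrrCount_eq_sum {e D : ℕ} (he : e ≠ 0) (hD : e * Module.finrank k K ≤ D) :
    absIrrCount m e K = ∑ i : IrrIndex m D k,
      if irrDim i = e * irrEndDeg i ∧ irrEndDeg i ∣ Module.finrank k K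
        then irrEndDeg i else 0 := by
  have hcard : ∀ i : IrrIndex m D k, Nat.card (OverClass e K (irrRep i)) =
      if irrDim i = e * irrEndDeg i ∧ irrEndDeg i ∣ Module.finrank k K
        then irrEndDeg i else 0 := by
    intro i
    have hdim : Module.finrank k (Fin i.1 → k) = irrDim i := by simp [irrDim]
    rw [card_overClass (irrRep i) inferInstance he (irrEndCard_eq i), hdim]
  have hfin : Finite (Quotient (absIrrSetoid m e K)) := Quotient.finite _
  simp_rw [← hcard]
  rw [← Nat.card_sigma, absIrrCount]
  -- Every class over `K` lies over exactly one irreducible representation over `k`.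
  refine (Nat.card_congr (Equiv.ofBijective
    (fun p : Σ i : IrrIndex m D k, OverClass e K (irrRep i) => p.2.1) ⟨?_, ?_⟩)).symm
  · rintro ⟨i, w, σ, hσ, hi⟩ ⟨j, w', σ', hσ', hj⟩ h
    obtain rfl : w = w' := h
    obtain ⟨ε⟩ := Quotient.exact (hσ'.trans hσ.symm)
    obtain rfl := irrRep_injective i j
      (LiesOver.unique σ.2.isIrreducible inferInstance inferInstance hi (hj.congr ε))
    rfl
  · intro w
    obtain ⟨σ, rfl⟩ := Quotient.exists_rep w
    obtain ⟨i, hi⟩ := exists_liesOver_irrRep (k := k) he hD σ.1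
    exact ⟨⟨i, _, σ, rfl, hi⟩, rfl⟩

end DescentCount

/-! ### Matching the logarithmic derivative with the Adams operators -/

section Adams

variable {m : ℕ} {k : Type} [Field k] [Finite k]

/-- The descent formula involves `K` only through its degree over `k`. This later replaces the
degree one extension by `k` itself. -/
theorem absIrrCount_congr {e : ℕ} (he : e ≠ 0) {K K' : Type} [Field K] [Finite K] [Algebra k K]
    [Field K'] [Finite K'] [Algebra k K'] (h : Module.finrank k K = Module.finrank k K') :
    absIrrCount m e K = absIrrCount m e K' := by
  rw [absIrrCount_eq_sum (k := k) he le_rfl, absIrrCount_eq_sum (k := k) (K := K') he (Nat.mul_le_mul_left e h.ge), h]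

theorem exists_extension_family (k : Type) [Field k] [Finite k] :
    ∃ (L : ℕ → Type) (_ : ∀ r, Field (L r)) (_ : ∀ r, Finite (L r)) (_ : ∀ r, Algebra k (L r)),
      ∀ r, r ≠ 0 → Module.finrank k (L r) = r := by
  obtain ⟨p, hp⟩ := CharP.exists k
  have : Fact p.Prime := ⟨CharP.char_is_prime k p⟩
  refine ⟨fun r => FiniteField.Extension k p (r - 1 + 1), fun r => inferInstance,
    fun r => inferInstance, fun r => inferInstance, fun r hr => ?_⟩
  rw [FiniteField.finrank_extension]
  omega

/-- The contribution of a single irreducible representation, of dimension `e * s` and with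
endomorphism field of degree `s`. -/
theorem sum_divisors_single {q : ℚ} {n e s : ℕ} (hn : n ≠ 0) (he : e ≠ 0) (hs : s ≠ 0) :
    (if e * s ∣ n ∧ n ≠ 0 then ((e * s : ℕ) : ℚ) * (1 - (q ^ s) ^ (n / (e * s)))⁻¹ else 0) =
      -n * ∑ r ∈ n.divisors, (r : ℚ)⁻¹ *
        (((if e * s = n / r * s ∧ s ∣ r then s else 0 : ℕ) : ℚ) / (q ^ r - 1)) := by
  have hs' : (s : ℚ) ≠ 0 := Nat.cast_ne_zero.2 hs
  by_cases h : e * s ∣ n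
  · obtain ⟨l, rfl⟩ := h
    have hl : l ≠ 0 := by rintro rfl; simp at hn
    have hl' : (l : ℚ) ≠ 0 := Nat.cast_ne_zero.2 hl
    have hsl : 0 < s * l := Nat.mul_pos (Nat.pos_of_ne_zero hs) (Nat.pos_of_ne_zero hl)
    have hdiv : e * s * l / (s * l) = e := by rw [mul_assoc]; exact Nat.mul_div_cancel _ hsl
    -- With `n = e s l`, the conditions `n / r = e` and `s ∣ r` leave only `r = s l`.
    rw [if_pos ⟨dvd_mul_right _ _, hn⟩, Nat.mul_div_cancel_left _ (by positivity),
      Finset.sum_eq_single (s * l)]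
    · rw [if_pos ⟨by rw [hdiv], dvd_mul_right _ _⟩, ← pow_mul, ← neg_sub, inv_neg]
      push_cast
      field_simp
    · intro r hr hne
      rw [if_neg, Nat.cast_zero, zero_div, mul_zero]
      rintro ⟨h1, -⟩
      apply hne
      have h2 := Nat.eq_of_mul_eq_mul_right (Nat.pos_of_ne_zero hs) h1
      have h3 := Nat.div_mul_cancel (Nat.dvd_of_mem_divisors hr)
      rw [← h2, mul_assoc] at h3
      exact Nat.eq_of_mul_eq_mul_left (Nat.pos_of_ne_zero he) h3
    · intro h
      exact absurd (Nat.mem_divisors.2 ⟨⟨e, by ring⟩, hn⟩) h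
  · rw [if_neg fun h' => h h'.1, Finset.sum_eq_zero, mul_zero]
    intro r hr
    rw [if_neg, Nat.cast_zero, zero_div, mul_zero]
    rintro ⟨h1, l, rfl⟩
    apply h
    rw [h1]
    exact ⟨l, by
      conv_lhs => rw [← Nat.div_mul_cancel (Nat.dvd_of_mem_divisors hr)]
      ring⟩

/-- Insert the descent formula for each `L r` and exchange the sums; each irreducible representation
then contributes the identity `sum_divisors_single`. Dimension `n / r` over a degree `r` extension
needs only irreducibles of dimension at most `n ≤ D`. -/
theorem irrLogCoeff_eq (L : ℕ → Type) [∀ r, Field (L r)] [∀ r, Finite (L r)]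
    [∀ r, Algebra k (L r)] (hL : ∀ r, r ≠ 0 → Module.finrank k (L r) = r) {n D : ℕ} (hn : n ≠ 0)
    (hD : n ≤ D) :
    irrLogCoeff m D k n = -n * ∑ r ∈ n.divisors, (r : ℚ)⁻¹ *
      ((absIrrCount m (n / r) (L r) : ℚ) / ((Nat.card k : ℚ) ^ r - 1)) := by
  have hcount : ∀ r ∈ n.divisors, (absIrrCount m (n / r) (L r) : ℚ) =
      ∑ i : IrrIndex m D k,
        ((if irrDim i = n / r * irrEndDeg i ∧ irrEndDeg i ∣ r then irrEndDeg i else 0 : ℕ) : ℚ) := by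
    intro r hr
    have hdvd := Nat.dvd_of_mem_divisors hr
    have hr0 : r ≠ 0 := (Nat.pos_of_mem_divisors hr).ne'
    rw [absIrrCount_eq_sum (k := k) (D := D)
      (Nat.div_pos (Nat.le_of_dvd (Nat.pos_of_ne_zero hn) hdvd) (Nat.pos_of_ne_zero hr0)).ne'
      (by rwa [hL r hr0, Nat.div_mul_cancel hdvd]), hL r hr0, Nat.cast_sum]
  rw [Finset.sum_congr rfl fun r hr => by rw [hcount r hr, Finset.sum_div, Finset.mul_sum],
    Finset.sum_comm, Finset.mul_sum, irrLogCoeff]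
  refine Finset.sum_congr rfl fun i _ => ?_
  obtain ⟨e, he⟩ := irrEndDeg_dvd_irrDim i
  rw [mul_comm] at he
  rw [irrEndCard_eq, he, Nat.cast_pow]
  refine sum_divisors_single hn ?_ (irrEndDeg_pos i).ne'
  rintro rfl
  exact irrDim_ne_zero i (by rw [he, zero_mul])

end Adams

/-! ### Interpolation over all finite fields -/

section UniversalSeries

theorem HasVal.of_recursion {a : ℚ} {D : ℕ} {s : ℕ → RatFunc ℚ} {σ : ℕ → ℚ}
    {g : ℕ → ℕ → RatFunc ℚ} {γ : ℕ → ℕ → ℚ}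
    (hs : ∀ n, s n = (if n = 0 then 1 else 0) - ∑ d ∈ Finset.range n, s d * g n d)
    (hσ : ∀ n ≤ D, σ n = (if n = 0 then 1 else 0) - ∑ d ∈ Finset.range n, σ d * γ n d)
    (hg : ∀ n d, d < n → HasVal a (g n d) (γ n d)) : ∀ n ≤ D, HasVal a (s n) (σ n) := by
  intro n
  induction n using Nat.strong_induction_on with
  | _ n ih =>
    intro hn
    rw [hs, hσ n hn]
    refine HasVal.sub ?_ (HasVal.sum _ _ _ fun d hd => ?_)
    · split_ifs
      · exact HasVal.one
      · exact HasVal.zero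
    · have hd := Finset.mem_range.1 hd
      exact (ih d hd (by omega)).mul (hg n d hd)

theorem HasVal.stabCard {a : ℚ} (n d : ℕ) :
    HasVal a (stabCard (RatFunc.X : RatFunc ℚ) n d) (CharVar.stabCard a n d) :=
  HasVal.prod _ _ _ fun i _ => (HasVal.X.pow n).sub (HasVal.X.pow i)

/-- The coefficients of the series that interpolates `irrProduct` over all finite fields. -/
noncomputable def universalCoeff (m : ℕ) (n : ℕ) : RatFunc ℚ :=
  (if n = 0 then 1 else 0) -
    ∑ d : Fin n, universalCoeff m d * stabCard RatFunc.X n d ^ ((m : ℤ) - 1)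
termination_by n
decreasing_by exact d.2

theorem universalCoeff_eq (m n : ℕ) : universalCoeff m n = (if n = 0 then 1 else 0) -
    ∑ d ∈ Finset.range n, universalCoeff m d * stabCard RatFunc.X n d ^ ((m : ℤ) - 1) := by
  rw [universalCoeff, Fin.sum_univ_eq_sum_range
    fun d => universalCoeff m d * stabCard (RatFunc.X : RatFunc ℚ) n d ^ ((m : ℤ) - 1)]

theorem universalCoeff_zero (m : ℕ) : universalCoeff m 0 = 1 := by
  simp [universalCoeff_eq m 0]

/-- Both sides obey the same recursion: the last term of `sum_coeff_irrProduct` has coefficient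
`stab(n,n) = 1`, so it can be solved for the top coefficient. In particular the coefficients up to
`D` do not depend on the cutoff. -/
theorem hasVal_universalCoeff (m D : ℕ) (k : Type) [Field k] [Finite k] :
    ∀ n ≤ D, HasVal (Nat.card k : ℚ) (universalCoeff m n)
      (PowerSeries.coeff n (irrProduct m D k)) := by
  refine HasVal.of_recursion (γ := fun n d => stabCard (Nat.card k : ℚ) n d ^ ((m : ℤ) - 1))
    (universalCoeff_eq m) (fun n hn => ?_) fun n d _ =>
    (HasVal.stabCard n d).zpow (stabCard_nat_pos Finite.one_lt_card n d).ne' _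
  rcases Nat.eq_zero_or_pos n with rfl | h
  · simpa using coeff_zero_irrProduct m D k
  · have := sum_coeff_irrProduct (m := m) (k := k) h hn
    rw [Finset.sum_range_succ, stabCard, Finset.Ico_self, Finset.prod_empty, one_zpow,
      mul_one] at this
    rw [if_neg h.ne', zero_sub]
    linarith

/-- The series that interpolates `irrProduct` over all finite fields. -/
noncomputable def universalSeries (m : ℕ) : (RatFunc ℚ)⟦X⟧ := PowerSeries.mk (universalCoeff m)

/-- The logarithmic derivative of the universal series. -/
noncomputable def universalLog (m : ℕ) : (RatFunc ℚ)⟦X⟧ :=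
  eulerDeriv (universalSeries m) * (universalSeries m)⁻¹

theorem universalLog_mul (m : ℕ) :
    universalLog m * universalSeries m = eulerDeriv (universalSeries m) := by
  rw [universalLog, mul_assoc, PowerSeries.inv_mul_cancel, mul_one]
  rw [← PowerSeries.coeff_zero_eq_constantCoeff_apply, universalSeries, PowerSeries.coeff_mk,
    universalCoeff_zero]
  exact one_ne_zero

theorem hasVal_coeff_universalLog (m n : ℕ) (k : Type) [Field k] [Finite k] :
    HasVal (Nat.card k : ℚ) (PowerSeries.coeff n (universalLog m)) (irrLogCoeff m n k n) := by
  have hf : ∀ j ≤ n, HasVal (Nat.card k : ℚ) (PowerSeries.coeff j (universalSeries m))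
      (PowerSeries.coeff j (irrProduct m n k)) := fun j hj => by
    rw [universalSeries, PowerSeries.coeff_mk]
    exact hasVal_universalCoeff m n k j hj
  have h := HasVal.coeff_of_mul_eq hf
    (fun j hj => by
      rw [coeff_eulerDeriv, coeff_eulerDeriv]
      exact (HasVal.natCast j).mul (hf j hj))
    (by rw [universalSeries, PowerSeries.coeff_mk, universalCoeff_zero])
    (coeff_zero_irrProduct m n k) (universalLog_mul m) (eulerDeriv_irrProduct m n k).symm n le_rfl
  rwa [PowerSeries.coeff_mk] at h

theorem hasVal_universalLog_div {m n : ℕ} (hn : n ≠ 0) {k : Type} [Field k] [Finite k]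
    (L : ℕ → Type) [∀ r, Field (L r)] [∀ r, Finite (L r)]
    [∀ r, Algebra k (L r)] (hL : ∀ r, r ≠ 0 → Module.finrank k (L r) = r) :
    HasVal (Nat.card k : ℚ) (-(PowerSeries.coeff n (universalLog m) / n))
      (∑ r ∈ n.divisors, (r : ℚ)⁻¹ *
        ((absIrrCount m (n / r) (L r) : ℚ) / ((Nat.card k : ℚ) ^ r - 1))) := by
  have hn' : (n : ℚ) ≠ 0 := Nat.cast_ne_zero.2 hn
  have h := ((hasVal_coeff_universalLog m n k).div (HasVal.natCast n) hn').neg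
  rwa [irrLogCoeff_eq L hL hn le_rfl, neg_mul, neg_div, neg_neg, mul_div_cancel_left₀ _ hn'] at h

end UniversalSeries

/-! ### Existence and uniqueness of the counting polynomials -/

section CountingPolynomials

variable {m : ℕ}

theorem infinite_setOf_prime_cast : ((fun p : ℕ => (p : ℚ)) '' {p | p.Prime}).Infinite :=
  Nat.infinite_setOfPred_prime.image Nat.cast_injective.injOn

theorem eq_of_hasVal_prime {r r' : RatFunc ℚ}
    (h : ∀ p : ℕ, p.Prime → ∃ v, HasVal (p : ℚ) r v ∧ HasVal (p : ℚ) r' v) : r = r' := by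
  -- The common values are expressed through evaluation of `r`, which avoids choosing a `v` for each
  -- prime.
  refine HasVal.eq_of_infinite infinite_setOf_prime_cast (RatFunc.eval (RingHom.id ℚ) · r) ?_ ?_ <;>
  · rintro _ ⟨p, hp, rfl⟩
    obtain ⟨v, h1, h2⟩ := h p hp
    simp only [h1.eval_eq]
    assumption

theorem IsCountingPolynomial.unique {n : ℕ} {A B : ℚ[X]} (hA : IsCountingPolynomial m n A)
    (hB : IsCountingPolynomial m n B) : A = B := by
  refine Polynomial.eq_of_infinite_eval_eq _ _ (infinite_setOf_prime_cast.mono ?_)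
  rintro _ ⟨p, hp, rfl⟩
  have : Fact p.Prime := ⟨hp⟩
  have h := (hA (ZMod p)).trans (hB (ZMod p)).symm
  rwa [Nat.card_zmod] at h

/-- The value of an Adams summand at the order of a finite field. -/
theorem IsCountingPolynomial.hasVal_substPow {A : ℚ[X]} {e r : ℕ} (hA : IsCountingPolynomial m e A)
    {k L : Type} [Field k] [Finite k] [Field L] [Finite L] [Algebra k L]
    (hr : r ≠ 0) (hL : Module.finrank k L = r) :
    HasVal (Nat.card k : ℚ) (substPow r (algebraMap ℚ[X] (RatFunc ℚ) A / (RatFunc.X - 1)))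
      ((absIrrCount m e L : ℚ) / ((Nat.card k : ℚ) ^ r - 1)) := by
  have : Module.Finite k L := Module.Finite.of_finite
  have hcard : (Nat.card L : ℚ) = (Nat.card k : ℚ) ^ r := by
    rw [Module.natCard_eq_pow_finrank (K := k) (V := L), hL, Nat.cast_pow]
  have hq : (1 : ℚ) < Nat.card k := by exact_mod_cast Finite.one_lt_card
  refine HasVal.substPow ?_
  rw [← hA L, ← hcard]
  refine (HasVal.ofPolynomial A).div (HasVal.X.sub HasVal.one) ?_
  rw [hcard]
  exact (sub_pos.2 (one_lt_pow₀ hq hr)).ne'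

/-- In the divisor sum for the logarithm, every `r > 1` involves a smaller dimension `n / r`.
Solving for the `r = 1` term gives a rational function `R` whose value at `|k|` is the count, for
every `k`; integrality at the primes makes `R` a polynomial. -/
theorem exists_isCountingPolynomial (m n : ℕ) (hn : 1 ≤ n) :
    ∃ A : ℚ[X], IsCountingPolynomial m n A := by
  induction n using Nat.strong_induction_on with
  | _ n ih =>
    have hn0 : n ≠ 0 := by omega
    -- Outside `1 ≤ j < n` the chosen polynomial is `0`; those values are never used.
    have hex : ∀ j, ∃ A : ℚ[X], 1 ≤ j → j < n → IsCountingPolynomial m j A := fun j => by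
      by_cases h : 1 ≤ j ∧ j < n
      · obtain ⟨A, hA⟩ := ih j h.2 h.1
        exact ⟨A, fun _ _ => hA⟩
      · exact ⟨0, fun h1 h2 => absurd ⟨h1, h2⟩ h⟩
    choose A hA using hex
    set R : RatFunc ℚ := (RatFunc.X - 1) * (-(PowerSeries.coeff n (universalLog m) / (n : RatFunc ℚ)) -
      ∑ r ∈ n.divisors.erase 1, (r : RatFunc ℚ)⁻¹ *
        substPow r (algebraMap ℚ[X] (RatFunc ℚ) (A (n / r)) / (RatFunc.X - 1))) with hR
    have key : ∀ (k : Type) [Field k] [Finite k],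
        HasVal (Nat.card k : ℚ) R (absIrrCount m n k) := by
      intro k _ _
      obtain ⟨L, _, _, _, hL⟩ := exists_extension_family k
      have hq : (1 : ℚ) < Nat.card k := by exact_mod_cast Finite.one_lt_card
      have hq' : (Nat.card k : ℚ) - 1 ≠ 0 := (sub_pos.2 hq).ne'
      have h1 := (hasVal_universalLog_div (m := m) hn0 L hL).sub
        (HasVal.sum (n.divisors.erase 1) _ _ fun r hr => by
          obtain ⟨hr1, hr⟩ := Finset.mem_erase.1 hr
          have hr0 := Nat.pos_of_mem_divisors hr
          have hle := Nat.le_of_dvd (by omega) (Nat.dvd_of_mem_divisors hr)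
          exact ((HasVal.natCast r).inv (Nat.cast_ne_zero.2 hr0.ne')).mul
            ((hA (n / r) (Nat.div_pos hle hr0)
              (Nat.div_lt_self hn (by omega))).hasVal_substPow hr0.ne' (hL r hr0.ne')))
      have h2 := (HasVal.X.sub HasVal.one).mul h1
      -- Subtracting the terms `r ≠ 1` leaves the count over `L 1` divided by `q - 1`.
      rw [← Finset.add_sum_erase _ _ (Nat.one_mem_divisors.2 hn0), add_sub_cancel_right,
        Nat.div_one, Nat.cast_one, inv_one, one_mul, pow_one, mul_div_cancel₀ _ hq',
        absIrrCount_congr (k := k) (K' := k) hn0 (by rw [hL 1 one_ne_zero, Module.finrank_self])]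
        at h2
      exact h2
    obtain ⟨P, hP⟩ := exists_eq_algebraMap_of_int Nat.infinite_setOfPred_prime fun p hp => by
      have : Fact p.Prime := ⟨hp⟩
      have h := key (ZMod p)
      rw [Nat.card_zmod] at h
      exact ⟨absIrrCount m n (ZMod p), by exact_mod_cast h⟩
    exact ⟨P, fun k _ _ => (HasVal.ofPolynomial P).unique (hP ▸ key k)⟩

theorem coeff_Psi_irrSeries (A : ℕ → ℚ[X]) {n : ℕ} (hn : n ≠ 0) :
    PowerSeries.coeff n (Psi (irrSeries A)) = ∑ r ∈ n.divisors, (r : RatFunc ℚ)⁻¹ *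
        substPow r (algebraMap ℚ[X] (RatFunc ℚ) (A (n / r)) / (RatFunc.X - 1)) := by
  rw [Psi, PowerSeries.coeff_mk]
  symm
  refine Finset.sum_subset_zero_on_sdiff (fun r hr => ?_) (fun r hr => ?_) fun r hr => ?_
  · exact Finset.mem_Icc.2 ⟨Nat.pos_of_mem_divisors hr, Nat.divisor_le hr⟩
  · have h : ¬ r ∣ n := fun h => (Finset.mem_sdiff.1 hr).2 (Nat.mem_divisors.2 ⟨h, hn⟩)
    rw [adams, PowerSeries.coeff_mk, if_neg h, mul_zero]
  · have hdvd := Nat.dvd_of_mem_divisors hr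
    have h0 : n / r ≠ 0 := (Nat.div_pos (Nat.divisor_le hr) (Nat.pos_of_mem_divisors hr)).ne'
    rw [adams, PowerSeries.coeff_mk, if_pos hdvd, irrSeries, PowerSeries.coeff_mk, if_neg h0]

/-- Coefficientwise, `Ψ` of the series is minus the logarithm of the universal series: both rational
functions have the same value at every prime. -/
theorem coeff_Psi_irrSeries_eq_universalLog {A : ℕ → ℚ[X]}
    (hA : ∀ n, 1 ≤ n → IsCountingPolynomial m n (A n)) {n : ℕ} (hn : n ≠ 0) :
    PowerSeries.coeff n (Psi (irrSeries A)) = -(PowerSeries.coeff n (universalLog m) / n) := by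
  refine eq_of_hasVal_prime fun p hp => ?_
  have : Fact p.Prime := ⟨hp⟩
  obtain ⟨L, _, _, _, hL⟩ := exists_extension_family (ZMod p)
  have h := hasVal_universalLog_div (m := m) hn L hL
  have h' := HasVal.sum (a := Nat.card (ZMod p)) n.divisors _ _ fun r hr =>
    have hr0 := Nat.pos_of_mem_divisors hr
    ((HasVal.natCast r).inv (Nat.cast_ne_zero.2 hr0.ne')).mul
      ((hA (n / r) (Nat.div_pos (Nat.divisor_le hr) hr0)).hasVal_substPow hr0.ne' (hL r hr0.ne'))
  rw [← coeff_Psi_irrSeries A hn] at h'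
  rw [Nat.card_zmod] at h h'
  exact ⟨_, h', h⟩

end CountingPolynomials

/-! ### Specialization at `q = 1` -/

section Specialization

/-- The factor of `stabCard` that remains after division by its zero at `q = 1`. -/
theorem hasVal_stabCard_div {n d : ℕ} (hd : d ≤ n) :
    HasVal 1 (stabCard RatFunc.X n d / (RatFunc.X - 1) ^ (n - d)) ((n - d).factorial : ℚ) := by
  have hX : (RatFunc.X - 1 : RatFunc ℚ) ≠ 0 := by
    rw [sub_ne_zero, ← RatFunc.algebraMap_X, ← map_one (algebraMap ℚ[X] (RatFunc ℚ))]
    intro h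
    simpa using congrArg (Polynomial.eval 0) (RatFunc.algebraMap_injective ℚ h)
  have h1 : stabCard (RatFunc.X : RatFunc ℚ) n d / (RatFunc.X - 1) ^ (n - d) =
      ∏ i ∈ Finset.Ico d n, RatFunc.X ^ i * ∑ j ∈ Finset.range (n - i), RatFunc.X ^ j := by
    rw [div_eq_iff (pow_ne_zero _ hX), stabCard, ← Nat.card_Ico d n, ← Finset.prod_const,
      ← Finset.prod_mul_distrib]
    refine Finset.prod_congr rfl fun i hi => ?_
    have hi := (Finset.mem_Ico.1 hi).2.le
    rw [mul_assoc, geom_sum_mul, mul_sub, mul_one, ← pow_add, Nat.add_sub_cancel' hi]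
  have h2 : ((n - d).factorial : ℚ) =
      ∏ i ∈ Finset.Ico d n, 1 ^ i * ∑ j ∈ Finset.range (n - i), (1 : ℚ) ^ j := by
    simp only [one_pow, Finset.sum_const, Finset.card_range, nsmul_eq_mul, mul_one, one_mul]
    -- The factors `n - i` for `d ≤ i < n` are `1, …, n - d` in decreasing order.
    rw [← Nat.cast_prod, Finset.prod_Ico_eq_prod_range, ← Finset.prod_range_add_one_eq_factorial,
      ← Finset.prod_range_reflect]
    congr 1
    refine Finset.prod_congr rfl fun i hi => ?_
    have := Finset.mem_range.1 hi
    omega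
  rw [h1, h2]
  exact HasVal.prod _ _ _ fun i _ => (HasVal.X.pow i).mul
    (HasVal.sum _ _ _ fun j _ => HasVal.X.pow j)

/-- The series `∑_n (n!) ^ (m - 1) x ^ n`. -/
noncomputable def factorialSeries (m : ℕ) : ℚ⟦X⟧ :=
  PowerSeries.mk fun n => (n.factorial : ℚ) ^ ((m : ℤ) - 1)

theorem factorialSeries_inv_mul (m : ℕ) : (factorialSeries m)⁻¹ * factorialSeries m = 1 := by
  refine PowerSeries.inv_mul_cancel _ ?_
  rw [← PowerSeries.coeff_zero_eq_constantCoeff_apply, factorialSeries, PowerSeries.coeff_mk]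
  simp

theorem coeff_factorialSeries_inv (m n : ℕ) : PowerSeries.coeff n (factorialSeries m)⁻¹ =
    (if n = 0 then 1 else 0) - ∑ d ∈ Finset.range n,
      PowerSeries.coeff d (factorialSeries m)⁻¹ * ((n - d).factorial : ℚ) ^ ((m : ℤ) - 1) := by
  have h := congrArg (PowerSeries.coeff n) (factorialSeries_inv_mul m)
  rw [PowerSeries.coeff_mul, Finset.Nat.sum_antidiagonal_eq_sum_range_succ_mk,
    Finset.sum_range_succ, PowerSeries.coeff_one] at h
  simp only [Nat.sub_self] at h
  rw [← h, factorialSeries]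
  simp only [PowerSeries.coeff_mk]
  simp

/-- The scaling factor of the variable. -/
noncomputable def scaleFactor (m : ℕ) : RatFunc ℚ :=
  ((RatFunc.X - 1 : RatFunc ℚ) ^ ((m : ℤ) - 1))⁻¹

/-- Rescaling distributes the power of `q - 1` over the recursion, dividing `stab(n,d)` by
`(q-1)^{n-d}`. At `q = 1` it becomes the recursion for the inverse of `factorialSeries`. -/
theorem hasVal_rescale_universalSeries (m n : ℕ) :
    HasVal 1 (PowerSeries.coeff n (PowerSeries.rescale (scaleFactor m) (universalSeries m)))
      (PowerSeries.coeff n (factorialSeries m)⁻¹) := by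
  refine HasVal.of_recursion (D := n)
    (s := fun n => PowerSeries.coeff n
      (PowerSeries.rescale (scaleFactor m) (universalSeries m)))
    (σ := fun n => PowerSeries.coeff n (factorialSeries m)⁻¹)
    (g := fun n d => (stabCard RatFunc.X n d / (RatFunc.X - 1) ^ (n - d)) ^ ((m : ℤ) - 1))
    (γ := fun n d => ((n - d).factorial : ℚ) ^ ((m : ℤ) - 1))
    (fun n => ?_) (fun n _ => coeff_factorialSeries_inv m n) (fun n d h =>
      (hasVal_stabCard_div h.le).zpow (Nat.cast_ne_zero.2 (Nat.factorial_ne_zero _)) _) n le_rfl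
  simp only [PowerSeries.coeff_rescale, universalSeries, PowerSeries.coeff_mk]
  rw [universalCoeff_eq, mul_sub, Finset.mul_sum]
  congr 1
  · split_ifs with h
    · rw [h, pow_zero, one_mul]
    · rw [mul_zero]
  · refine Finset.sum_congr rfl fun d hd => ?_
    have hd := (Finset.mem_range.1 hd).le
    have hs : scaleFactor m ^ n = scaleFactor m ^ d * scaleFactor m ^ (n - d) := by
      rw [← pow_add, Nat.add_sub_cancel' hd]
    rw [hs, div_zpow, scaleFactor, inv_pow _ (n - d), ← zpow_natCast _ (n - d), ← zpow_mul,
      mul_comm ((m : ℤ) - 1) ((n - d : ℕ) : ℤ), zpow_mul, zpow_natCast]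
    ring

/-- The generating series of the numbers of subgroups of given index. -/
noncomputable def subgroupCountSeries (m : ℕ) : ℚ⟦X⟧ :=
  PowerSeries.mk fun n => if n = 0 then 0 else ((indexSubgroups m n).ncard : ℚ)

/-- Hall's recursion as an identity of generating series. -/
theorem subgroupCountSeries_mul (m : ℕ) :
    subgroupCountSeries m * factorialSeries m = eulerDeriv (factorialSeries m) := by
  ext n
  rw [PowerSeries.coeff_mul, Finset.Nat.sum_antidiagonal_eq_sum_range_succ_mk, coeff_eulerDeriv,
    factorialSeries, PowerSeries.coeff_mk, ← sum_ncard_indexSubgroups m n]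
  simp only [subgroupCountSeries, PowerSeries.coeff_mk]

/-- Inverting a series changes the sign of its logarithmic derivative; differentiate `F⁻¹ F = 1`. -/
theorem neg_subgroupCountSeries_mul (m : ℕ) :
    -subgroupCountSeries m * (factorialSeries m)⁻¹ = eulerDeriv (factorialSeries m)⁻¹ := by
  have h1 := factorialSeries_inv_mul m
  have h2 := congrArg eulerDeriv h1
  rw [eulerDeriv_mul, eulerDeriv_one, ← subgroupCountSeries_mul] at h2
  linear_combination (eulerDeriv (factorialSeries m)⁻¹ +
    subgroupCountSeries m * (factorialSeries m)⁻¹) * h1 - (factorialSeries m)⁻¹ * h2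

theorem hasVal_rescale_universalLog (m n : ℕ) :
    HasVal 1 (PowerSeries.coeff n (PowerSeries.rescale (scaleFactor m) (universalLog m)))
      (-PowerSeries.coeff n (subgroupCountSeries m)) := by
  rw [← map_neg]
  refine HasVal.coeff_of_mul_eq (D := n)
    (fun j _ => hasVal_rescale_universalSeries m j) (fun j _ => ?_) ?_ ?_
    (g := eulerDeriv (PowerSeries.rescale (scaleFactor m) (universalSeries m)))
    (by rw [← map_mul, universalLog_mul, eulerDeriv_rescale])
    (neg_subgroupCountSeries_mul m) n le_rfl
  · rw [coeff_eulerDeriv, coeff_eulerDeriv]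
    exact (HasVal.natCast j).mul (hasVal_rescale_universalSeries m j)
  · rw [PowerSeries.coeff_rescale, universalSeries, PowerSeries.coeff_mk, universalCoeff_zero,
      pow_zero, one_mul]
  · rw [coeff_factorialSeries_inv]
    simp

/-- The sign in `Ψ = -log P` cancels that of the logarithmic derivative of `F⁻¹`, and passing from
the logarithmic derivative to the logarithm gives the factor `1/n`. -/
theorem hasVal_coeff_substT_Psi {m : ℕ} {A : ℕ → ℚ[X]}
    (hA : ∀ n, 1 ≤ n → IsCountingPolynomial m n (A n)) (n : ℕ) :
    HasVal 1 (PowerSeries.coeff n (substT m (Psi (irrSeries A))))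
      (PowerSeries.coeff n (subgroupSeries m)) := by
  rw [substT, PowerSeries.coeff_rescale, subgroupSeries, PowerSeries.coeff_mk]
  split_ifs with hn
  · subst hn
    rw [Psi, PowerSeries.coeff_mk, Finset.Icc_eq_empty (by norm_num), Finset.sum_empty, mul_zero]
    exact HasVal.zero
  · have h := ((hasVal_rescale_universalLog m n).div (HasVal.natCast n)
      (Nat.cast_ne_zero.2 hn)).neg
    rw [PowerSeries.coeff_rescale, subgroupCountSeries, PowerSeries.coeff_mk, if_neg hn,
      neg_div, neg_neg, mul_div_assoc, ← mul_neg,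
      ← coeff_Psi_irrSeries_eq_universalLog hA hn] at h
    exact h

end Specialization

end CharVar

theorem lemma6p5 (m : ℕ) :
    (∀ n : ℕ, 1 ≤ n → ∃! A : Polynomial ℚ, CharVar.IsCountingPolynomial m n A) ∧
    ∀ A : ℕ → Polynomial ℚ, (∀ n : ℕ, 1 ≤ n → CharVar.IsCountingPolynomial m n (A n)) →
      CharVar.SpecializesAtOne
        (CharVar.substT m (CharVar.Psi (CharVar.irrSeries A)))
        (CharVar.subgroupSeries m) := by
  refine ⟨fun n hn => ?_, fun A hA n => ?_⟩
  · obtain ⟨A, hA⟩ := CharVar.exists_isCountingPolynomial m n hn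
    exact ⟨A, hA, fun B hB => CharVar.IsCountingPolynomial.unique hB hA⟩
  · have h := CharVar.hasVal_coeff_substT_Psi hA n
    exact ⟨h.denom_eval_ne_zero, h.eval_eq⟩
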